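/- All Hilbert spaces are finite-dimensional. A rank-one quantum game $G=G(|\psi\rangle,|\gamma\rangle)$ is given by Hilbert spaces $\mathcal H_A,\mathcal H_B,\mathcal H_C$ and unit vectors $|\psi\rangle,|\gamma\rangle\in\mathcal H_A\otimes\mathcal H_B\otimes\mathcal H_C$: a referee prepares $|\psi\rangle$, sends the registers $A$ and $B$ to Alice and Bob respectively, receives these registers back, and accepts with the probability that the projective measurement $\{|\gamma\rangle\langle\gamma|,\,1-|\gamma\rangle\langle\gamma|\}$ of $ABC$ yields the outcome $|\gamma\rangle\langle\gamma|$. A quantum operation is a completely positive trace-preserving linear map. The entangled value with one-way communication is $$\omega_{qow}(G)=\sup\ \mathrm{tr}\Big(\big(|\gamma\rangle\langle\gamma|\otimes 1_{A'}\big)\,(T_{BA'}\otimes \mathrm{id}_{AC})\,(T_{AA'}\otimes\mathrm{id}_{BC})\big(|\psi\rangle\langle\psi|\otimes|0\rangle\langle0|_{A'}\big)\Big),$$ where the supremum is over all (nonzero) finite-dimensional auxiliary spaces $\mathcal H_{A'}$ with a fixed unit vector $|0\rangle$ and all quantum operations $T_{AA'}$ on $B(\mathcal H_A\otimes\mathcal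 H_{A'})$ and $T_{BA'}$ on $B(\mathcal H_B\otimes\mathcal H_{A'})$. The maximal value $V(G)$ is the optimal winning probability of a single player holding both $A$ and $B$, $$V(G)=\sup\ \mathrm{tr}\Big(\big(|\gamma\rangle\langle\gamma|\otimes 1_{E}\big)\,(W_{ABE}\otimes\mathrm{id}_C)\big(|\psi\rangle\langle\psi|\otimes|0\rangle\langle0|_{E}\big)\Big),$$ where the supremum is over all (nonzero) finite-dimensional $\mathcal H_E$ with a fixed unit vector $|0\rangle$ and all quantum operations $W_{ABE}$ on $B(\mathcal H_A\otimes\mathcal H_B\otimes\mathcal H_E)$. The $k$-fold parallel repetition $G^k$ is the rank-one quantum game $G(|\psi\rangle^{\otimes k},|\gamma\rangle^{\otimes k})$ with registers $\mathcal H_A^{\otimes k},\mathcal H_B^{\otimes k},\mathcal H_C^{\otimes k}$. **Theorem.** For every rank-one quantum game $G$ and every $k\in\mathbb N$: 1. $V(G)=\big\|\mathrm{tr}_C|\psi\rangle\langle\gamma|\big\|_{S_1(\mathcal H_A\otimes\mathcal H_B)}^2$ (the squared trace norm), and $V(G^k)=V(G)^k$; 2. $\omega_{qow}(G^k)=\omega_{qow}(G)^k$.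 -/

import Mathlib

open scoped Kronecker ComplexOrder

noncomputable section

/-! Finite-dimensional Hilbert spaces are `ℂ^A` with its Hilbert norm, for a finite type `A` that
labels an orthonormal basis; the tensor product of `ℂ^A` and `ℂ^B` is `ℂ^(A × B)`. -/

/-- `|x⟩⟨y|`. -/
def ketBra {n : Type*} (x y : EuclideanSpace ℂ n) : Matrix n n ℂ :=
  Matrix.vecMulVec (fun i => x i) (fun j => star (y j))

/-- The map `T ⊗ id_R` on `B(ℂ^n ⊗ ℂ^R)`. -/
def ampliation {n R : Type*} (T : Matrix n n ℂ →ₗ[ℂ] Matrix n n ℂ)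
    (X : Matrix (n × R) (n × R) ℂ) : Matrix (n × R) (n × R) ℂ :=
  Matrix.of fun p q => T (Matrix.of fun i j => X (i, p.2) (j, q.2)) p.1 q.1

/-- Quantum operations (channels): completely positive and trace preserving linear maps. -/
structure IsQuantumOperation {n : Type*} [Fintype n]
    (T : Matrix n n ℂ →ₗ[ℂ] Matrix n n ℂ) : Prop where
  trace_preserving : ∀ X : Matrix n n ℂ, (T X).trace = X.trace
  completely_positive : ∀ (m : ℕ) (X : Matrix (n × Fin m) (n × Fin m) ℂ),
    X.PosSemidef → (ampliation T X).PosSemidef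

/-- Apply `T`, which acts on the registers `n`, to a state on registers `Y` that split as `n`
together with a rest `R` (on which the identity acts). -/
def applyOn {Y n R : Type*} (e : Y ≃ n × R) (T : Matrix n n ℂ →ₗ[ℂ] Matrix n n ℂ)
    (ρ : Matrix Y Y ℂ) : Matrix Y Y ℂ :=
  (ampliation T (ρ.reindex e e)).reindex e.symm e.symm

/-- Select the registers `A` and `E` out of `A, B, C, E`. -/
def registersAE (A B C E : Type*) : (A × B × C) × E ≃ (A × E) × (B × C) where
  toFun x := ((x.1.1, x.2), x.1.2)
  invFun y := ((y.1.1, y.2), y.1.2)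
  left_inv _ := rfl
  right_inv _ := rfl

/-- Select the registers `B` and `E` out of `A, B, C, E`. -/
def registersBE (A B C E : Type*) : (A × B × C) × E ≃ (B × E) × (A × C) where
  toFun x := ((x.1.2.1, x.2), (x.1.1, x.1.2.2))
  invFun y := ((y.2.1, y.1.1, y.2.2), y.1.2)
  left_inv _ := rfl
  right_inv _ := rfl

/-- Select the registers `A`, `B` and `E` out of `A, B, C, E`. -/
def registersABE (A B C E : Type*) : (A × B × C) × E ≃ (A × B × E) × C where
  toFun x := ((x.1.1, x.1.2.1, x.2), x.1.2.2)
  invFun y := ((y.1.1, y.1.2.1, y.2), y.1.2.2)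
  left_inv _ := rfl
  right_inv _ := rfl

/-- A rank-one quantum game: the referee prepares the state `ψ`, sends the registers `A` and `B`
to the players, keeps `C`, and finally measures the returned registers together with `C` against
the state `γ`. -/
structure RankOneGame (A B C : Type*) [Fintype A] [Fintype B] [Fintype C] where
  ψ : EuclideanSpace ℂ (A × B × C)
  γ : EuclideanSpace ℂ (A × B × C)
  norm_ψ : ‖ψ‖ = 1
  norm_γ : ‖γ‖ = 1

/-- The `k`-fold tensor power of a vector, with the registers of the `k` copies grouped together. -/
def tensorPower {A B C : Type*} (ψ : EuclideanSpace ℂ (A × B × C)) (k : ℕ) :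
    EuclideanSpace ℂ ((Fin k → A) × (Fin k → B) × (Fin k → C)) :=
  WithLp.toLp 2 fun x => ∏ i, ψ (x.1 i, x.2.1 i, x.2.2 i)

theorem norm_tensorPower {A B C : Type*} [Fintype A] [Fintype B] [Fintype C]
    (ψ : EuclideanSpace ℂ (A × B × C)) (k : ℕ) : ‖tensorPower ψ k‖ = ‖ψ‖ ^ k := by
  classical
  have h : ‖tensorPower ψ k‖ ^ 2 = (‖ψ‖ ^ k) ^ 2 := by
    rw [EuclideanSpace.norm_sq_eq, ← pow_mul, mul_comm, pow_mul, EuclideanSpace.norm_sq_eq]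
    let e : (Fin k → A × B × C) ≃ (Fin k → A) × (Fin k → B) × (Fin k → C) :=
      { toFun := fun f => (fun i => (f i).1, fun i => (f i).2.1, fun i => (f i).2.2)
        invFun := fun x i => (x.1 i, x.2.1 i, x.2.2 i)
        left_inv := fun _ => rfl
        right_inv := fun _ => rfl }
    rw [← e.sum_comp]
    have h1 : ∀ f : Fin k → A × B × C, ‖tensorPower ψ k (e f)‖ ^ 2 = ∏ i, ‖ψ (f i)‖ ^ 2 := by
      intro f
      simp [tensorPower, e, Finset.prod_pow]
    simp_rw [h1]
    exact (Fintype.sum_pow (fun x => ‖ψ x‖ ^ 2) k).symm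
  exact (sq_eq_sq₀ (norm_nonneg _) (by positivity)).1 h

namespace RankOneGame

variable {A B C : Type*} [Fintype A] [Fintype B] [Fintype C]

/-- The `k`-fold parallel repetition `G^k`. -/
def parallel (G : RankOneGame A B C) (k : ℕ) :
    RankOneGame (Fin k → A) (Fin k → B) (Fin k → C) where
  ψ := tensorPower G.ψ k
  γ := tensorPower G.γ k
  norm_ψ := by rw [norm_tensorPower, G.norm_ψ, one_pow]
  norm_γ := by rw [norm_tensorPower, G.norm_γ, one_pow]

/-- The initial global state `|ψ⟩⟨ψ| ⊗ |0⟩⟨0|`, with an auxiliary system of dimension `d + 1`. -/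
def initialState (G : RankOneGame A B C) (d : ℕ) :
    Matrix ((A × B × C) × Fin (d + 1)) ((A × B × C) × Fin (d + 1)) ℂ :=
  ketBra G.ψ G.ψ ⊗ₖ ketBra (EuclideanSpace.single 0 1) (EuclideanSpace.single 0 1)

/-- The probability `tr((|γ⟩⟨γ| ⊗ 1) ρ)` that the referee accepts the final global state `ρ`. -/
def winProb (G : RankOneGame A B C) {d : ℕ}
    (ρ : Matrix ((A × B × C) × Fin (d + 1)) ((A × B × C) × Fin (d + 1)) ℂ) : ℝ :=
  ((ketBra G.γ G.γ ⊗ₖ (1 : Matrix (Fin (d + 1)) (Fin (d + 1)) ℂ)) * ρ).trace.re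

/-- The entangled value with one-way communication: Alice acts on `A` and the auxiliary system,
then sends the latter to Bob, who acts on `B` and the auxiliary system. -/
def oneWayValue (G : RankOneGame A B C) : ℝ :=
  sSup {p : ℝ | ∃ (d : ℕ)
    (T : Matrix (A × Fin (d + 1)) (A × Fin (d + 1)) ℂ →ₗ[ℂ]
      Matrix (A × Fin (d + 1)) (A × Fin (d + 1)) ℂ)
    (S : Matrix (B × Fin (d + 1)) (B × Fin (d + 1)) ℂ →ₗ[ℂ]
      Matrix (B × Fin (d + 1)) (B × Fin (d + 1)) ℂ),
    IsQuantumOperation T ∧ IsQuantumOperation S ∧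
      p = G.winProb (applyOn (registersBE A B C (Fin (d + 1))) S
        (applyOn (registersAE A B C (Fin (d + 1))) T (G.initialState d)))}

/-- The maximal value: the optimal winning probability of a single player who has access to both
`A` and `B` and to an auxiliary system. -/
def maximalValue (G : RankOneGame A B C) : ℝ :=
  sSup {p : ℝ | ∃ (d : ℕ)
    (W : Matrix (A × B × Fin (d + 1)) (A × B × Fin (d + 1)) ℂ →ₗ[ℂ]
      Matrix (A × B × Fin (d + 1)) (A × B × Fin (d + 1)) ℂ),
    IsQuantumOperation W ∧
      p = G.winProb (applyOn (registersABE A B C (Fin (d + 1))) W (G.initialState d))}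

/-- The matrix `M_AB = tr_C |ψ⟩⟨γ|`. -/
def gameMatrix (G : RankOneGame A B C) : Matrix (A × B) (A × B) ℂ :=
  Matrix.of fun p q => ∑ c, ketBra G.ψ G.γ (p.1, p.2, c) (q.1, q.2, c)

end RankOneGame

/-- The trace norm (norm of `S_1`): the sum of the singular values, i.e. of the square roots of
the eigenvalues of `Mᴴ M`. -/
def traceNorm {n : Type*} [Fintype n] [DecidableEq n] (M : Matrix n n ℂ) : ℝ :=
  ∑ i, √((Matrix.isHermitian_conjTranspose_mul_self M).eigenvalues i)

end

noncomputable section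

/-! Both values depend on the game only through M = tr_C |ψ⟩⟨γ|. In Kraus form every winning
probability is a sum of squares |tr (M X)|², where X runs over blocks of the players' Kraus
operators. Each value is then characterised by a primal strategy together with a dual certificate,
and both kinds of witness are closed under tensor powers. As M(G^k) is M^{⊗k} up to regrouping
registers, the k-th power of an optimal pair is an optimal pair for G^k, which gives
multiplicativity in both directions at once.

For V(G), the certificate is a positive block matrix [[P, M], [Mᴴ, Q]] with tr P = tr Q = t;
Cauchy–Schwarz turns it into the bound t² (`sum_norm_trace_mul_sq_le`). The polar decomposition of M
supplies both a certificate and a matching Kraus family at t = ‖M‖₁ (`exists_polar_decomposition`,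
`maximalValue_eq_sq`).

For the one-way value, the primal quantity is the supremum t of |∑ tr (M (V_e ⊗ R_e))| over columns
with ∑ V_eᴴ V_e = 1 and rows with ∑ R_e R_eᴴ = 1. The certificate is a pair of states ρ, σ with |tr
(M (V ⊗ R))|² ≤ t² tr (V ρ Vᴴ) tr (Rᴴ σ R), encoded as positivity of `dualMatrix`. This is the
Haagerup-type factorisation of a bilinear form; its existence (`exists_posSemidef_dualMatrix`)
follows from Sion's minimax theorem. The certificate bounds arbitrary strategies
(`winProb_krausMap_krausMap_le`), while amplitudes are realised by strategies
(`exists_kraus_of_mem_amplitudes`). -/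

/-! ### Positive semidefinite matrices -/

open Matrix in
theorem Matrix.PosSemidef.exists_eq_conjTranspose_mul_self {n : Type*} [Fintype n]
    {Z : Matrix n n ℂ} (hZ : Z.PosSemidef) : ∃ L : Matrix n n ℂ, Z = Lᴴ * L := by
  classical
  open scoped MatrixOrder in
  exact CStarAlgebra.nonneg_iff_eq_star_mul_self.1 (Matrix.nonneg_iff_posSemidef.2 hZ)

open Matrix in
theorem Matrix.trace_conjTranspose_mul_self_eq_sum {m n : Type*} [Fintype m] [Fintype n]
    (X : Matrix m n ℂ) : (Xᴴ * X).trace = ((∑ j, ∑ i, ‖X i j‖ ^ 2 : ℝ) : ℂ) := by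
  simp [Matrix.trace, Matrix.mul_apply, Matrix.diag, Complex.conj_mul']

open Matrix in
theorem Matrix.PosSemidef.trace_mul_nonneg {n : Type*} [Fintype n] {X Y : Matrix n n ℂ}
    (hX : X.PosSemidef) (hY : Y.PosSemidef) : 0 ≤ (X * Y).trace := by
  obtain ⟨L, rfl⟩ := hX.exists_eq_conjTranspose_mul_self
  rw [Matrix.mul_assoc, Matrix.trace_mul_comm]
  exact (hY.mul_mul_conjTranspose_same L).trace_nonneg

theorem Matrix.PosSemidef.norm_apply_le_trace {n : Type*} [Fintype n] {Z : Matrix n n ℂ}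
    (hZ : Z.PosSemidef) (i j : n) : ‖Z i j‖ ≤ Z.trace.re := by
  obtain ⟨L, rfl⟩ := hZ.exists_eq_conjTranspose_mul_self
  rw [Matrix.trace_conjTranspose_mul_self_eq_sum, Complex.ofReal_re]
  have h : ∀ a : n, ∑ l, ‖L l a‖ ^ 2 ≤ ∑ j, ∑ i, ‖L i j‖ ^ 2 := fun a =>
    Finset.single_le_sum (f := fun j => ∑ i, ‖L i j‖ ^ 2)
      (fun _ _ => by positivity) (Finset.mem_univ a)
  calc ‖(L.conjTranspose * L) i j‖ ≤ ∑ l, ‖L l i‖ * ‖L l j‖ := by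
        rw [Matrix.mul_apply]
        refine (norm_sum_le _ _).trans (le_of_eq ?_)
        simp
    _ ≤ ∑ l, (‖L l i‖ ^ 2 + ‖L l j‖ ^ 2) / 2 := by
        gcongr with l
        nlinarith [sq_nonneg (‖L l i‖ - ‖L l j‖)]
    _ ≤ _ := by
        rw [← Finset.sum_div, Finset.sum_add_distrib]
        linarith [h i, h j]

/-- Density matrices: positive semidefinite matrices of trace one. -/
def densityMatrices (n : Type*) [Fintype n] : Set (Matrix n n ℂ) :=
  {ρ | ρ.PosSemidef ∧ ρ.trace = 1}

theorem convex_densityMatrices (n : Type*) [Fintype n] : Convex ℝ (densityMatrices n) := by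
  intro x hx y hy a b ha hb hab
  refine ⟨(hx.1.smul ha).add (hy.1.smul hb), ?_⟩
  rw [Matrix.trace_add, Matrix.trace_smul, Matrix.trace_smul, hx.2, hy.2, ← add_smul, hab, one_smul]

theorem isClosed_posSemidef (n : Type*) [Fintype n] :
    IsClosed {ρ : Matrix n n ℂ | ρ.PosSemidef} := by
  simp_rw [Matrix.posSemidef_iff_dotProduct_mulVec, Set.ofPred_and, Set.ofPred_forall]
  refine IsClosed.inter (isClosed_eq (by fun_prop) continuous_id) (isClosed_iInter fun x => ?_)
  exact isClosed_le continuous_const (by fun_prop)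

theorem isCompact_densityMatrices (n : Type*) [Fintype n] : IsCompact (densityMatrices n) := by
  have hK : IsCompact (Set.univ.pi fun _ : n => Set.univ.pi fun _ : n =>
      Metric.closedBall (0 : ℂ) 1) :=
    isCompact_univ_pi fun _ => isCompact_univ_pi fun _ => isCompact_closedBall _ _
  refine hK.of_isClosed_subset ?_ ?_
  · exact (isClosed_posSemidef n).inter (isClosed_eq (by fun_prop) continuous_const)
  · intro ρ hρ i _ j _
    have := hρ.1.norm_apply_le_trace i j
    rw [hρ.2] at this
    simpa using this

theorem vecMulVec_mem_densityMatrices {n : Type*} [Fintype n] {x : n → ℂ}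
    (hx : star x ⬝ᵥ x = 1) : Matrix.vecMulVec x (star x) ∈ densityMatrices n := by
  refine ⟨Matrix.posSemidef_vecMulVec_self_star x, ?_⟩
  rw [Matrix.trace_vecMulVec, dotProduct_comm, hx]

theorem nonempty_densityMatrices (n : Type*) [Fintype n] [Nonempty n] :
    (densityMatrices n).Nonempty := by
  classical
  obtain ⟨i⟩ := ‹Nonempty n›
  exact ⟨_, vecMulVec_mem_densityMatrices (x := Pi.single i 1) (by simp [Pi.star_def])⟩

theorem exists_smul_vecMulVec_mem_densityMatrices {n : Type*} [Fintype n] {x : n → ℂ}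
    (hx : x ≠ 0) : ∃ s : ℝ, 0 < s ∧ star x ⬝ᵥ x = s ∧
      s⁻¹ • Matrix.vecMulVec x (star x) ∈ densityMatrices n := by
  have hs : 0 < star x ⬝ᵥ x := Matrix.dotProduct_star_self_pos_iff.2 hx
  obtain ⟨s, hs0, hsx⟩ : ∃ s : ℝ, 0 < s ∧ star x ⬝ᵥ x = (s : ℂ) := by
    obtain ⟨h1, h2⟩ := Complex.pos_iff.1 hs
    exact ⟨_, h1, Complex.ext rfl (by simpa using h2.symm)⟩
  refine ⟨s, hs0, hsx, (Matrix.posSemidef_vecMulVec_self_star x).smul (by positivity), ?_⟩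
  rw [Matrix.trace_smul, Matrix.trace_vecMulVec, dotProduct_comm, hsx]
  simp [hs0.ne']

/-- The largest eigenvalue, attained at a density matrix. -/
theorem Matrix.IsHermitian.exists_densityMatrix_max {n : Type*} [Fintype n] [DecidableEq n]
    [Nonempty n] {X : Matrix n n ℂ} (hX : X.IsHermitian) :
    ∃ ρ ∈ densityMatrices n, ((ρ * X).trace.re • (1 : Matrix n n ℂ) - X).PosSemidef := by
  have hc : Continuous fun ρ : Matrix n n ℂ => (ρ * X).trace.re := by fun_prop
  obtain ⟨ρ, hρ, hmax⟩ := (isCompact_densityMatrices n).exists_isMaxOn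
    (nonempty_densityMatrices n) hc.continuousOn
  have hH : ((ρ * X).trace.re • (1 : Matrix n n ℂ) - X).IsHermitian := by
    refine Matrix.IsHermitian.sub ?_ hX
    rw [Matrix.IsHermitian, Matrix.conjTranspose_smul]; simp
  refine ⟨ρ, hρ, Matrix.PosSemidef.of_dotProduct_mulVec_nonneg hH fun x => ?_⟩
  refine Complex.nonneg_iff.2 ⟨?_, (hH.im_star_dotProduct_mulVec_self x).symm⟩
  obtain rfl | hx := eq_or_ne x 0
  · simp
  -- Comparing the maximiser ρ with the normalised pure state of x gives the Rayleigh quotient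
  -- bound.
  obtain ⟨s, hs0, hsx, hmem⟩ := exists_smul_vecMulVec_mem_densityMatrices hx
  have h := hmax hmem
  simp only [Set.mem_ofPred_eq, Matrix.smul_mul, Matrix.trace_smul, Matrix.vecMulVec_mul,
    Matrix.trace_vecMulVec] at h
  rw [dotProduct_comm, ← Matrix.dotProduct_mulVec, Complex.smul_re, smul_eq_mul,
    inv_mul_le_iff₀ hs0] at h
  rw [Matrix.sub_mulVec, dotProduct_sub, Matrix.smul_mulVec, Matrix.one_mulVec, dotProduct_smul,
    hsx]
  simp only [Complex.sub_re, Complex.smul_re, Complex.ofReal_re, smul_eq_mul]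
  linarith

/-! ### Tensor products of families of matrices -/

/-- The tensor product of a finite sequence of matrices. -/
def tensorMatrix {k : ℕ} {m n : Type*} (V : Fin k → Matrix m n ℂ) :
    Matrix (Fin k → m) (Fin k → n) ℂ :=
  Matrix.of fun f g => ∏ i, V i (f i) (g i)

section tensorMatrix

variable {k : ℕ} {l m n : Type*}

open Matrix

theorem tensorMatrix_apply (V : Fin k → Matrix m n ℂ) (f : Fin k → m) (g : Fin k → n) :
    tensorMatrix V f g = ∏ i, V i (f i) (g i) := rfl

theorem tensorMatrix_mul [Fintype m] [DecidableEq m] (V : Fin k → Matrix l m ℂ)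
    (W : Fin k → Matrix m n ℂ) :
    tensorMatrix V * tensorMatrix W = tensorMatrix fun i => V i * W i := by
  ext f g
  simp only [Matrix.mul_apply, tensorMatrix_apply, Finset.prod_univ_sum, Fintype.piFinset_univ,
    Finset.prod_mul_distrib]

theorem tensorMatrix_conjTranspose (V : Fin k → Matrix m n ℂ) :
    (tensorMatrix V)ᴴ = tensorMatrix fun i => (V i)ᴴ := by
  ext f g
  simp [tensorMatrix_apply]

theorem tensorMatrix_one [DecidableEq n] :
    tensorMatrix (fun _ : Fin k => (1 : Matrix n n ℂ)) = 1 := by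
  ext f g
  simp [tensorMatrix_apply, Matrix.one_apply, Finset.prod_ite_zero, funext_iff]

theorem trace_tensorMatrix [Fintype n] [DecidableEq n] (V : Fin k → Matrix n n ℂ) :
    (tensorMatrix V).trace = ∏ i, (V i).trace := by
  simp only [Matrix.trace, Matrix.diag, tensorMatrix_apply, Finset.prod_univ_sum,
    Fintype.piFinset_univ]

theorem sum_tensorMatrix {ι : Type*} [Fintype ι] [DecidableEq ι] (V : ι → Matrix m n ℂ) :
    ∑ ε : Fin k → ι, tensorMatrix (fun i => V (ε i)) = tensorMatrix fun _ => ∑ e, V e := by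
  ext f g
  simp only [Matrix.sum_apply, tensorMatrix_apply, Finset.prod_univ_sum, Fintype.piFinset_univ]

theorem Matrix.PosSemidef.tensorMatrix [Finite n] {V : Fin k → Matrix n n ℂ}
    (hV : ∀ i, (V i).PosSemidef) : (tensorMatrix V).PosSemidef := by
  classical
  have := Fintype.ofFinite n
  choose L hL using fun i => (hV i).exists_eq_conjTranspose_mul_self
  rw [show V = fun i => (L i)ᴴ * L i from funext hL, ← tensorMatrix_mul,
    ← tensorMatrix_conjTranspose]
  exact posSemidef_conjTranspose_mul_self _

end tensorMatrix

/-! ### Kraus decompositions -/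

section Kraus

open Matrix

/-- The map `X ↦ ∑ i, K i * X * (K i)ᴴ`. -/
def krausMap {n ι : Type*} [Fintype n] [Fintype ι] (K : ι → Matrix n n ℂ) :
    Matrix n n ℂ →ₗ[ℂ] Matrix n n ℂ where
  toFun X := ∑ i, K i * X * (K i)ᴴ
  map_add' X Y := by simp [Matrix.mul_add, Matrix.add_mul, Finset.sum_add_distrib]
  map_smul' c X := by simp [Finset.smul_sum]

theorem krausMap_apply {n ι : Type*} [Fintype n] [Fintype ι] (K : ι → Matrix n n ℂ)
    (X : Matrix n n ℂ) : krausMap K X = ∑ i, K i * X * (K i)ᴴ := rfl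

theorem ampliation_krausMap {n ι R : Type*} [Fintype n] [Fintype ι] [Fintype R] [DecidableEq R]
    (K : ι → Matrix n n ℂ) (X : Matrix (n × R) (n × R) ℂ) :
    ampliation (krausMap K) X =
      ∑ i, (K i ⊗ₖ (1 : Matrix R R ℂ)) * X * (K i ⊗ₖ (1 : Matrix R R ℂ))ᴴ := by
  ext ⟨p, r⟩ ⟨q, s⟩
  simp [ampliation, krausMap_apply, Matrix.sum_apply, Matrix.mul_apply, Fintype.sum_prod_type,
    Matrix.one_apply, ite_mul, apply_ite]

theorem isQuantumOperation_krausMap {n ι : Type*} [Fintype n] [DecidableEq n] [Fintype ι]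
    {K : ι → Matrix n n ℂ} (hK : ∑ i, (K i)ᴴ * K i = 1) : IsQuantumOperation (krausMap K) where
  trace_preserving X := by
    rw [krausMap_apply, Matrix.trace_sum]
    simp_rw [Matrix.trace_mul_cycle (K _) X]
    rw [← Matrix.trace_sum, ← Finset.sum_mul, hK, one_mul]
  completely_positive m X hX := by
    rw [ampliation_krausMap]
    exact posSemidef_sum _ fun i _ => hX.mul_mul_conjTranspose_same _

/-- Choi's argument: `T ⊗ id` applied to the unnormalised maximally entangled vector `ω` gives a
positive matrix `Lᴴ * L` whose blocks are the values of `T` on matrix units. The conjugated rows of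
`L`, reshaped, are the Kraus operators. -/
theorem IsQuantumOperation.exists_kraus {n : Type*} [Fintype n] [DecidableEq n]
    {T : Matrix n n ℂ →ₗ[ℂ] Matrix n n ℂ} (hT : IsQuantumOperation T) :
    ∃ (N : ℕ) (K : Fin N → Matrix n n ℂ), T = krausMap K ∧ ∑ i, (K i)ᴴ * K i = 1 := by
  let e := Fintype.equivFin n
  let ω : n × Fin (Fintype.card n) → ℂ := fun p => if e p.1 = p.2 then 1 else 0
  have hC := hT.completely_positive _ _ (posSemidef_vecMulVec_self_star ω)
  obtain ⟨L, hL⟩ := hC.exists_eq_conjTranspose_mul_self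
  have hE : ∀ a b : n, (Matrix.of fun i j => vecMulVec ω (star ω) (i, e a) (j, e b)) =
      Matrix.single a b (1 : ℂ) := by
    intro a b
    ext i j
    simp [ω, vecMulVec_apply, Matrix.single_apply, eq_comm, ← ite_and, and_comm]
  let f := Fintype.equivFin (n × Fin (Fintype.card n))
  let K : Fin (Fintype.card (n × Fin (Fintype.card n))) → Matrix n n ℂ :=
    fun s => Matrix.of fun i a => star (L (f.symm s) (i, e a))
  have hTE : ∀ a b i j, T (Matrix.single a b 1) i j = ∑ s, K s i a * star (K s j b) := by
    intro a b i j
    have := congrFun (congrFun hL (i, e a)) (j, e b)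
    rw [ampliation, Matrix.of_apply] at this
    simp only [hE] at this
    rw [this, Matrix.mul_apply, ← f.symm.sum_comp]
    simp [K]
  refine ⟨_, K, ?_, ?_⟩
  · refine Matrix.ext_linearMap _ fun a b => LinearMap.ext_ring ?_
    ext i j
    change T (Matrix.single a b 1) i j = krausMap K (Matrix.single a b 1) i j
    rw [hTE, krausMap_apply, Matrix.sum_apply]
    refine Finset.sum_congr rfl fun s _ => ?_
    simp [Matrix.mul_apply, Matrix.single_apply, ite_and]
  · ext b a
    have := hT.trace_preserving (Matrix.single a b 1)
    simp only [Matrix.trace, Matrix.diag, hTE] at this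
    rw [Matrix.sum_apply]
    simp only [Matrix.mul_apply, Matrix.conjTranspose_apply]
    rw [Finset.sum_comm]
    simp_rw [mul_comm (star _)]
    rw [this]
    simp [Matrix.single_apply, Matrix.one_apply, ite_and]

end Kraus

/-! ### Winning probabilities in terms of Kraus operators -/

section applyOn

open Matrix

variable {Y n R : Type*} [Fintype n]

/-- The operator `K ⊗ 1` applied to a vector on registers `Y` that split as `n` and a rest `R`. -/
def actOn (e : Y ≃ n × R) (K : Matrix n n ℂ) (u : Y → ℂ) : Y → ℂ :=
  fun y => ∑ x, K (e y).1 x * u (e.symm (x, (e y).2))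

theorem applyOn_krausMap {ι κ : Type*} [Fintype ι] [Fintype κ] (e : Y ≃ n × R)
    (K : ι → Matrix n n ℂ) (u : κ → Y → ℂ) :
    applyOn e (krausMap K) (∑ s, vecMulVec (u s) (star (u s))) =
      ∑ p : ι × κ, vecMulVec (actOn e (K p.1) (u p.2)) (star (actOn e (K p.1) (u p.2))) := by
  ext y z
  simp only [applyOn, ampliation, krausMap_apply, Matrix.reindex_apply, Matrix.submatrix_apply,
    Matrix.of_apply, Matrix.sum_apply, Fintype.sum_prod_type, Equiv.symm_symm]
  refine Finset.sum_congr rfl fun i _ => ?_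
  simp only [Matrix.mul_apply, Matrix.of_apply, vecMulVec_apply, actOn, Pi.star_apply, star_sum,
    star_mul', Finset.sum_mul, Finset.mul_sum, Matrix.conjTranspose_apply]
  rw [Finset.sum_congr rfl fun _ _ => Finset.sum_comm, Finset.sum_comm]
  refine Finset.sum_congr rfl fun s _ => ?_
  refine Finset.sum_congr rfl fun a _ => Finset.sum_congr rfl fun b _ => ?_
  ring

end applyOn

namespace RankOneGame

open Matrix

variable {A B C : Type*} [Fintype A] [Fintype B] [Fintype C] (G : RankOneGame A B C)

/-- The vector `|ψ⟩ ⊗ |0⟩`. -/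
def initialVector (d : ℕ) : (A × B × C) × Fin (d + 1) → ℂ :=
  fun y => if y.2 = 0 then G.ψ y.1 else 0

theorem initialState_eq (d : ℕ) :
    G.initialState d = ∑ _ : Unit, vecMulVec (G.initialVector d) (star (G.initialVector d)) := by
  ext ⟨y, e⟩ ⟨z, f⟩
  simp only [initialState, initialVector, ketBra, vecMulVec_apply, Matrix.kroneckerMap_apply,
    Finset.univ_unique, Finset.sum_singleton, Pi.star_apply]
  by_cases he : e = 0 <;> by_cases hf : f = 0 <;> simp [he, hf]

theorem winProb_sum_vecMulVec {κ : Type*} [Fintype κ] {d : ℕ}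
    (u : κ → (A × B × C) × Fin (d + 1) → ℂ) :
    G.winProb (∑ s, vecMulVec (u s) (star (u s))) =
      ∑ s, ∑ e, ‖∑ y, star (G.γ y) * u s (y, e)‖ ^ 2 := by
  rw [winProb, Matrix.mul_sum, Matrix.trace_sum, Complex.re_sum]
  refine Finset.sum_congr rfl fun s _ => ?_
  rw [Matrix.mul_vecMulVec, Matrix.trace_vecMulVec, ← Complex.ofReal_re (∑ e, _)]
  congr 1
  push_cast
  simp_rw [← Complex.mul_conj']
  have hmul : ∀ y e, ((ketBra G.γ G.γ ⊗ₖ (1 : Matrix (Fin (d + 1)) (Fin (d + 1)) ℂ)) *ᵥ u s)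
      (y, e) = G.γ y * ∑ z, star (G.γ z) * u s (z, e) := by
    intro y e
    simp [mulVec, dotProduct, Fintype.sum_prod_type, ketBra, vecMulVec_apply, Matrix.one_apply,
      Finset.mul_sum, mul_assoc]
  simp only [dotProduct]
  rw [Fintype.sum_prod_type_right]
  refine Finset.sum_congr rfl fun e _ => ?_
  simp_rw [hmul, Pi.star_apply]
  rw [map_sum, Finset.mul_sum]
  refine Finset.sum_congr rfl fun y _ => ?_
  simp
  ring

end RankOneGame

namespace RankOneGame

open Matrix

variable {A B C : Type*} [Fintype A] [Fintype B] [Fintype C] (G : RankOneGame A B C)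

/-- The trace is the transition amplitude ⟨γ| K ⊗ 1_C |ψ⟩, which is why only the game matrix
matters. -/
theorem trace_gameMatrix_mul (K : Matrix (A × B) (A × B) ℂ) :
    (G.gameMatrix * K).trace =
      ∑ y, star (G.γ y) * ∑ x : A × B, K (y.1, y.2.1) x * G.ψ (x.1, x.2, y.2.2) := by
  rw [Matrix.trace_mul_comm]
  simp only [Matrix.trace, Matrix.diag, Matrix.mul_apply, gameMatrix, ketBra, Matrix.of_apply,
    vecMulVec_apply]
  rw [Fintype.sum_prod_type, Fintype.sum_prod_type]
  refine Finset.sum_congr rfl fun a _ => ?_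
  rw [Fintype.sum_prod_type]
  refine Finset.sum_congr rfl fun b _ => ?_
  simp only [Finset.mul_sum]
  rw [Finset.sum_comm]
  refine Finset.sum_congr rfl fun c _ => Finset.sum_congr rfl fun x _ => ?_
  ring

theorem sum_mul_initialVector {d : ℕ} (g : Fin (d + 1) → ℂ) (y : A × B × C) :
    ∑ f, g f * G.initialVector d (y, f) = g 0 * G.ψ y := by
  rw [Finset.sum_eq_single 0]
  · simp [initialVector]
  · intro f _ hf
    simp [initialVector, hf]
  · simp

/-- The block `⟨e| K |0⟩` of an operator `K` on the registers `A`, `B` and the auxiliary one. -/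
def jointBlock {d : ℕ} (K : Matrix (A × B × Fin (d + 1)) (A × B × Fin (d + 1)) ℂ)
    (e : Fin (d + 1)) : Matrix (A × B) (A × B) ℂ :=
  Matrix.of fun p q => K (p.1, p.2, e) (q.1, q.2, 0)

/-- The block `⟨e| K |f⟩` of an operator `K` on a register and the auxiliary one. -/
def auxBlock {n : Type*} {d : ℕ} (K : Matrix (n × Fin (d + 1)) (n × Fin (d + 1)) ℂ)
    (e f : Fin (d + 1)) : Matrix n n ℂ :=
  Matrix.of fun p q => K (p, e) (q, f)

theorem winProb_krausMap {ι : Type*} [Fintype ι] {d : ℕ}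
    (K : ι → Matrix (A × B × Fin (d + 1)) (A × B × Fin (d + 1)) ℂ) :
    G.winProb (applyOn (registersABE A B C (Fin (d + 1))) (krausMap K) (G.initialState d)) =
      ∑ i, ∑ e, ‖(G.gameMatrix * jointBlock (K i) e).trace‖ ^ 2 := by
  rw [initialState_eq, applyOn_krausMap, winProb_sum_vecMulVec, Fintype.sum_prod_type]
  simp only [Finset.univ_unique, Finset.sum_singleton]
  refine Finset.sum_congr rfl fun i _ => Finset.sum_congr rfl fun e _ => ?_
  rw [trace_gameMatrix_mul]
  congr 3 with y
  congr 1
  simp [actOn, registersABE, sum_mul_initialVector, jointBlock, Fintype.sum_prod_type]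

/-- The message basis state `f` is summed coherently, inside the norm; the Kraus outcomes `i`, `j`
and the final auxiliary state `e` are summed incoherently. -/
theorem winProb_krausMap_krausMap {ι κ : Type*} [Fintype ι] [Fintype κ] {d : ℕ}
    (T : ι → Matrix (A × Fin (d + 1)) (A × Fin (d + 1)) ℂ)
    (S : κ → Matrix (B × Fin (d + 1)) (B × Fin (d + 1)) ℂ) :
    G.winProb (applyOn (registersBE A B C (Fin (d + 1))) (krausMap S)
        (applyOn (registersAE A B C (Fin (d + 1))) (krausMap T) (G.initialState d))) =
      ∑ j, ∑ i, ∑ e, ‖∑ f, (G.gameMatrix *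
        (auxBlock (T i) f 0 ⊗ₖ auxBlock (S j) e f)).trace‖ ^ 2 := by
  have hact : ∀ i j e y, actOn (registersBE A B C (Fin (d + 1))) (S j)
      (actOn (registersAE A B C (Fin (d + 1))) (T i) (G.initialVector d)) (y, e) =
      ∑ f, ∑ x : A × B, (auxBlock (T i) f 0 ⊗ₖ auxBlock (S j) e f) (y.1, y.2.1) x *
        G.ψ (x.1, x.2, y.2.2) := by
    intro i j e y
    simp only [actOn, registersBE, registersAE, auxBlock, Fintype.sum_prod_type,
      Equiv.coe_fn_mk, Equiv.coe_fn_symm_mk, sum_mul_initialVector,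
      Matrix.kroneckerMap_apply, Matrix.of_apply, Finset.mul_sum]
    rw [Finset.sum_comm]
    refine Finset.sum_congr rfl fun f _ => ?_
    rw [Finset.sum_comm]
    refine Finset.sum_congr rfl fun a _ => Finset.sum_congr rfl fun b _ => ?_
    ring
  rw [initialState_eq, applyOn_krausMap, applyOn_krausMap, winProb_sum_vecMulVec,
    Fintype.sum_prod_type]
  refine Finset.sum_congr rfl fun j _ => ?_
  rw [Fintype.sum_prod_type]
  refine Finset.sum_congr rfl fun i _ => ?_
  simp only [Finset.univ_unique, Finset.sum_singleton]
  refine Finset.sum_congr rfl fun e _ => ?_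
  simp_rw [trace_gameMatrix_mul, hact]
  rw [Finset.sum_comm (s := Finset.univ (α := Fin (d + 1)))]
  simp_rw [Finset.mul_sum]

end RankOneGame

/-! ### The trace norm -/

section traceNorm

open Matrix

variable {n : Type*} [Fintype n] [DecidableEq n]

/-- The matrix that has the eigenvectors of the Hermitian matrix `H`, with eigenvalues `f`. -/
def Matrix.IsHermitian.withEigenvalues {H : Matrix n n ℂ} (hH : H.IsHermitian) (f : n → ℝ) :
    Matrix n n ℂ :=
  (hH.eigenvectorUnitary : Matrix n n ℂ) * diagonal (fun i => (f i : ℂ)) *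
    (hH.eigenvectorUnitary : Matrix n n ℂ)ᴴ

namespace Matrix.IsHermitian

variable {H : Matrix n n ℂ} (hH : H.IsHermitian)

theorem withEigenvalues_eigenvalues : hH.withEigenvalues hH.eigenvalues = H :=
  hH.spectral_theorem.symm

theorem withEigenvalues_mul (f g : n → ℝ) :
    hH.withEigenvalues f * hH.withEigenvalues g = hH.withEigenvalues (f * g) := by
  have hU : (hH.eigenvectorUnitary : Matrix n n ℂ)ᴴ * (hH.eigenvectorUnitary : Matrix n n ℂ) = 1 :=
    Unitary.coe_star_mul_self _
  simp only [withEigenvalues, Matrix.mul_assoc]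
  rw [← Matrix.mul_assoc _ _ (diagonal _ * _), hU, Matrix.one_mul,
    ← Matrix.mul_assoc (diagonal _) (diagonal _), diagonal_mul_diagonal]
  simp

theorem withEigenvalues_one : hH.withEigenvalues 1 = 1 := by
  have hU : (hH.eigenvectorUnitary : Matrix n n ℂ) * (hH.eigenvectorUnitary : Matrix n n ℂ)ᴴ = 1 :=
    Unitary.coe_mul_star_self _
  simp [withEigenvalues, hU]

theorem withEigenvalues_zero : hH.withEigenvalues 0 = 0 := by
  simp [withEigenvalues]

theorem withEigenvalues_sub (f g : n → ℝ) :
    hH.withEigenvalues f - hH.withEigenvalues g = hH.withEigenvalues (f - g) := by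
  simp only [withEigenvalues, ← Matrix.sub_mul, ← Matrix.mul_sub, diagonal_sub]
  simp

theorem conjTranspose_withEigenvalues (f : n → ℝ) :
    (hH.withEigenvalues f)ᴴ = hH.withEigenvalues f := by
  simp only [withEigenvalues, conjTranspose_mul, conjTranspose_conjTranspose,
    diagonal_conjTranspose, Matrix.mul_assoc]
  congr 3
  ext i
  simp

theorem trace_withEigenvalues (f : n → ℝ) :
    (hH.withEigenvalues f).trace = ((∑ i, f i : ℝ) : ℂ) := by
  have hU : (hH.eigenvectorUnitary : Matrix n n ℂ)ᴴ * (hH.eigenvectorUnitary : Matrix n n ℂ) = 1 :=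
    Unitary.coe_star_mul_self _
  rw [withEigenvalues, trace_mul_cycle, hU, Matrix.one_mul, trace_diagonal, Complex.ofReal_sum]

theorem posSemidef_withEigenvalues {f : n → ℝ} (hf : ∀ i, 0 ≤ f i) :
    (hH.withEigenvalues f).PosSemidef :=
  (Matrix.PosSemidef.diagonal fun i => by simpa using hf i).mul_mul_conjTranspose_same _

end Matrix.IsHermitian

/-- The polar decomposition `M = Kᴴ * S`, where `K` is a partial isometry. -/
theorem exists_polar_decomposition (M : Matrix n n ℂ) :
    ∃ K S : Matrix n n ℂ, S.PosSemidef ∧ S.trace = traceNorm M ∧ K * M = S ∧ Kᴴ * S = M ∧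
      S * (K * Kᴴ) = S ∧ K * Kᴴ * K = K := by
  set hH := isHermitian_conjTranspose_mul_self M
  set l := hH.eigenvalues with hl
  have hl0 : ∀ i, 0 ≤ l i := fun i => eigenvalues_conjTranspose_mul_self_nonneg M i
  let r : n → ℝ := fun i => √(l i)
  -- Since `0⁻¹ = 0`, these are the eigenvalues of the pseudo-inverse of |M|, and K will be |M|⁺ Mᴴ.
  let g : n → ℝ := fun i => (√(l i))⁻¹
  have hMM : Mᴴ * M = hH.withEigenvalues l := hH.withEigenvalues_eigenvalues.symm
  have hgl : g * l = r := by
    ext i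
    simp only [g, r, Pi.mul_apply]
    rw [← div_eq_inv_mul, Real.div_sqrt]
  have hgrg : g * r * g = g := by
    ext i
    simp only [g, r, Pi.mul_apply]
    simpa only [inv_inv] using mul_inv_mul_cancel (√(l i))⁻¹
  have hrgr : r * (g * r) = r := by
    ext i
    simp only [g, r, Pi.mul_apply]
    rw [← mul_assoc, mul_inv_mul_cancel]
  have hKM : hH.withEigenvalues g * Mᴴ * M = hH.withEigenvalues r := by
    rw [Matrix.mul_assoc]
    exact (congrArg (hH.withEigenvalues g * ·) hMM).trans (by rw [hH.withEigenvalues_mul, hgl])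
  have hK : (hH.withEigenvalues g * Mᴴ)ᴴ = M * hH.withEigenvalues g := by
    rw [conjTranspose_mul, conjTranspose_conjTranspose, hH.conjTranspose_withEigenvalues]
  have hKK : hH.withEigenvalues g * Mᴴ * (M * hH.withEigenvalues g) =
      hH.withEigenvalues (r * g) := by
    rw [← Matrix.mul_assoc, hKM, hH.withEigenvalues_mul]
  -- `g * r` is the indicator of the support of |M|; M vanishes on the complement because the Gram
  -- matrix of `M * (1 - g * r)` is zero.
  have hMp : M * hH.withEigenvalues (g * r) = M := by
    rw [← sub_eq_zero, ← neg_eq_zero, neg_sub, ← conjTranspose_mul_self_eq_zero]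
    have : M - M * hH.withEigenvalues (g * r) = M * hH.withEigenvalues (1 - g * r) := by
      rw [← hH.withEigenvalues_sub, hH.withEigenvalues_one, Matrix.mul_sub, Matrix.mul_one]
    have hMMX : ∀ X, Mᴴ * M * X = hH.withEigenvalues l * X := fun X => congrArg (· * X) hMM
    rw [this, conjTranspose_mul, hH.conjTranspose_withEigenvalues, Matrix.mul_assoc,
      ← Matrix.mul_assoc Mᴴ, hMMX, hH.withEigenvalues_mul, hH.withEigenvalues_mul]
    convert hH.withEigenvalues_zero
    have hlr : l = r * r := by
      ext i
      exact (Real.mul_self_sqrt (hl0 i)).symm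
    have : l * (1 - g * r) = 0 := by
      rw [mul_sub, mul_one, hlr, mul_assoc, hrgr, sub_self]
    rw [this, mul_zero]
  refine ⟨hH.withEigenvalues g * Mᴴ, hH.withEigenvalues r,
    hH.posSemidef_withEigenvalues fun i => Real.sqrt_nonneg _, ?_, hKM, ?_, ?_, ?_⟩
  · rw [hH.trace_withEigenvalues]; rfl
  · rw [hK, Matrix.mul_assoc, hH.withEigenvalues_mul, hMp]
  · rw [hK, hKK, hH.withEigenvalues_mul, mul_comm r g, hrgr]
  · rw [hK, hKK, ← Matrix.mul_assoc, hH.withEigenvalues_mul, mul_comm r g, hgrg]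

/-- The trace norm of `M` is an optimum over Kraus families. -/
theorem exists_kraus_traceNorm_le (M : Matrix n n ℂ) :
    ∃ K : Fin 2 → Matrix n n ℂ, ∑ i, (K i)ᴴ * K i = 1 ∧
      traceNorm M ^ 2 ≤ ∑ i, ‖(M * K i).trace‖ ^ 2 := by
  obtain ⟨K, S, -, hS, hKM, -, -, hK⟩ := exists_polar_decomposition M
  -- Kᴴ K is a projection, so its complement completes K to a Kraus family; the first term alone
  -- already attains the bound.
  refine ⟨![K, 1 - Kᴴ * K], ?_, ?_⟩
  · have : Kᴴ * K * (Kᴴ * K) = Kᴴ * K := by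
      rw [Matrix.mul_assoc, ← Matrix.mul_assoc K, hK]
    simp [Fin.sum_univ_two, Matrix.mul_sub, Matrix.sub_mul, this]
  · simp only [Fin.sum_univ_two, Matrix.cons_val_zero]
    rw [Matrix.trace_mul_comm M K, hKM, hS, Complex.norm_real, Real.norm_eq_abs, sq_abs]
    exact le_add_of_nonneg_right (by positivity)

/-- The block matrix is [K | 1]ᴴ S [K | 1], with K and S from the polar decomposition. -/
theorem exists_posSemidef_fromBlocks_traceNorm (M : Matrix n n ℂ) :
    ∃ P Q : Matrix n n ℂ, (fromBlocks P M Mᴴ Q).PosSemidef ∧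
      P.trace = traceNorm M ∧ Q.trace = traceNorm M := by
  obtain ⟨K, S, hS0, hS, -, hM, hSK, -⟩ := exists_polar_decomposition M
  refine ⟨Kᴴ * S * K, S, ?_, ?_, hS⟩
  · have h := hS0.conjTranspose_mul_mul_same (fromCols K (1 : Matrix n n ℂ))
    rw [conjTranspose_fromCols_eq_fromRows_conjTranspose, fromRows_mul, fromRows_mul_fromCols] at h
    have hM' : Mᴴ = S * K := by
      rw [← hM, conjTranspose_mul, conjTranspose_conjTranspose, hS0.1.eq]
    simpa [hM, hM'] using h
  · rw [trace_mul_cycle, trace_mul_comm, hSK, hS]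

end traceNorm

/-! ### Upper bounds from a positive block matrix. -/

section weakDuality

open Matrix

theorem norm_sum_mul_sq_le {ι : Type*} (s : Finset ι) (x y : ι → ℂ) :
    ‖∑ i ∈ s, x i * y i‖ ^ 2 ≤ (∑ i ∈ s, ‖x i‖ ^ 2) * ∑ i ∈ s, ‖y i‖ ^ 2 := by
  refine le_trans ?_ (Finset.sum_mul_sq_le_sq_mul_sq s (fun i => ‖x i‖) fun i => ‖y i‖)
  gcongr
  refine (norm_sum_le _ _).trans (le_of_eq ?_)
  simp

/-- Self-duality of ℓ², tested at c = conj z. It reduces a sum over outcomes to one linear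
combination of amplitudes. -/
theorem sum_norm_sq_le_of_forall {ι : Type*} [Fintype ι] {z : ι → ℂ} {b : ℝ} (hb : 0 ≤ b)
    (h : ∀ c : ι → ℂ, ‖∑ i, c i * z i‖ ^ 2 ≤ (∑ i, ‖c i‖ ^ 2) * b) : ∑ i, ‖z i‖ ^ 2 ≤ b := by
  have h1 := h fun i => star (z i)
  have h2 : ∑ i, star (z i) * z i = ((∑ i, ‖z i‖ ^ 2 : ℝ) : ℂ) := by
    push_cast
    exact Finset.sum_congr rfl fun i _ => Complex.conj_mul' _
  rw [h2, Complex.norm_real, Real.norm_eq_abs, sq_abs, sq] at h1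
  simp only [norm_star] at h1
  by_contra! hlt
  have : 0 < ∑ i, ‖z i‖ ^ 2 := hb.trans_lt hlt
  nlinarith

/-- Factoring the block matrix gives M = Xᴴ Y, so tr (M K_f) is a Hilbert–Schmidt pairing of K_f Xᴴ
with Y. The total squared norm of the K_f Xᴴ is tr P and that of Y is tr Q. -/
theorem sum_norm_trace_mul_sq_le {n ι : Type*} [Fintype n] [DecidableEq n] [Fintype ι]
    {P M Q : Matrix n n ℂ} {t : ℝ} (h : (fromBlocks P M Mᴴ Q).PosSemidef) (hP : P.trace = t)
    (hQ : Q.trace = t) {K : ι → Matrix n n ℂ} (hK : ∑ i, (K i)ᴴ * K i = 1) :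
    ∑ i, ‖(M * K i).trace‖ ^ 2 ≤ t ^ 2 := by
  obtain ⟨L, hL⟩ := h.exists_eq_conjTranspose_mul_self
  set X := L.submatrix id Sum.inl
  set Y := L.submatrix id Sum.inr
  have hPX : P = Xᴴ * X := by
    ext i j
    exact congrFun (congrFun hL (Sum.inl i)) (Sum.inl j)
  have hMX : M = Xᴴ * Y := by
    ext i j
    exact congrFun (congrFun hL (Sum.inl i)) (Sum.inr j)
  have hQX : Q = Yᴴ * Y := by
    ext i j
    exact congrFun (congrFun hL (Sum.inr i)) (Sum.inr j)
  have hY : ∑ j, ∑ i, ‖Y i j‖ ^ 2 = t := by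
    have := trace_conjTranspose_mul_self_eq_sum Y
    rw [← hQX, hQ] at this
    exact_mod_cast this.symm
  have hKX : ∑ f, ∑ l, ∑ i, ‖(K f * Xᴴ) i l‖ ^ 2 = t := by
    have : ∑ f, ((K f * Xᴴ)ᴴ * (K f * Xᴴ)).trace = t := by
      simp_rw [conjTranspose_mul, conjTranspose_conjTranspose, Matrix.mul_assoc]
      simp_rw [← Matrix.mul_assoc (K _)ᴴ]
      rw [← trace_sum, ← Matrix.mul_sum, ← Matrix.sum_mul, hK, Matrix.one_mul, trace_mul_comm,
        ← hPX, hP]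
    simp_rw [trace_conjTranspose_mul_self_eq_sum] at this
    exact_mod_cast this
  refine sum_norm_sq_le_of_forall (by positivity) fun c => ?_
  have hsum : ∑ f, c f * (M * K f).trace =
      ∑ p : n × (n ⊕ n), (∑ f, c f * (K f * Xᴴ) p.1 p.2) * Y p.2 p.1 := by
    have htr : ∀ f, (M * K f).trace = ∑ i, ∑ l, (K f * Xᴴ) i l * Y l i := by
      intro f
      rw [trace_mul_comm, hMX, ← Matrix.mul_assoc]
      rfl
    simp_rw [htr, Fintype.sum_prod_type, Finset.sum_mul, Finset.mul_sum]
    rw [Finset.sum_comm]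
    refine Finset.sum_congr rfl fun i _ => ?_
    rw [Finset.sum_comm]
    simp_rw [mul_assoc]
  rw [hsum]
  refine (norm_sum_mul_sq_le _ _ _).trans ?_
  have h1 : ∑ p : n × (n ⊕ n), ‖Y p.2 p.1‖ ^ 2 = t := by rw [Fintype.sum_prod_type, hY]
  have h2 : ∑ p : n × (n ⊕ n), ‖∑ f, c f * (K f * Xᴴ) p.1 p.2‖ ^ 2 ≤ (∑ f, ‖c f‖ ^ 2) * t := by
    calc _ ≤ ∑ p : n × (n ⊕ n), (∑ f, ‖c f‖ ^ 2) * ∑ f, ‖(K f * Xᴴ) p.1 p.2‖ ^ 2 :=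
          Finset.sum_le_sum fun p _ => norm_sum_mul_sq_le _ _ _
      _ = _ := by
          rw [← Finset.mul_sum, Finset.sum_comm, ← hKX]
          simp_rw [Fintype.sum_prod_type_right]
  have ht : 0 ≤ t := by rw [← hY]; positivity
  rw [h1, sq, ← mul_assoc]
  gcongr

end weakDuality

theorem Matrix.trace_submatrix_equiv {m n : Type*} [Fintype m] [Fintype n] (M : Matrix n n ℂ)
    (e : m ≃ n) : (M.submatrix e e).trace = M.trace :=
  e.sum_comp fun i => M i i

/-! ### The maximal value -/

namespace RankOneGame

open Matrix

variable {A B C : Type*} [Fintype A] [Fintype B] [Fintype C]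

theorem sum_jointBlock [DecidableEq A] [DecidableEq B] {ι : Type*} [Fintype ι] {d : ℕ}
    {K : ι → Matrix (A × B × Fin (d + 1)) (A × B × Fin (d + 1)) ℂ}
    (hK : ∑ i, (K i)ᴴ * K i = 1) :
    ∑ p : ι × Fin (d + 1), (jointBlock (K p.1) p.2)ᴴ * jointBlock (K p.1) p.2 = 1 := by
  ext ⟨a, b⟩ ⟨a', b'⟩
  have h := congrFun (congrFun hK (a, b, 0)) (a', b', 0)
  simp only [Matrix.sum_apply, Matrix.mul_apply, Matrix.conjTranspose_apply, jointBlock,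
    Matrix.of_apply, Fintype.sum_prod_type, Matrix.one_apply, Prod.mk.injEq, and_true] at h ⊢
  rw [← h]
  refine Finset.sum_congr rfl fun i _ => ?_
  rw [Finset.sum_comm]
  refine Finset.sum_congr rfl fun a _ => ?_
  rw [Finset.sum_comm]

variable (G : RankOneGame A B C)

/-- The witnesses P, Q, K are kept abstract so that the lemma serves both G and, with tensor powers
of the witnesses, G^k. -/
theorem maximalValue_eq_sq [DecidableEq A] [DecidableEq B] {ι : Type*} [Fintype ι] {t : ℝ}
    {P Q : Matrix (A × B) (A × B) ℂ}
    (h : (fromBlocks P G.gameMatrix G.gameMatrixᴴ Q).PosSemidef) (hP : P.trace = t)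
    (hQ : Q.trace = t) {K : ι → Matrix (A × B) (A × B) ℂ} (hK : ∑ i, (K i)ᴴ * K i = 1)
    (hKt : t ^ 2 ≤ ∑ i, ‖(G.gameMatrix * K i).trace‖ ^ 2) : G.maximalValue = t ^ 2 := by
  have hub : ∀ p ∈ {p : ℝ | ∃ (d : ℕ)
      (W : Matrix (A × B × Fin (d + 1)) (A × B × Fin (d + 1)) ℂ →ₗ[ℂ]
        Matrix (A × B × Fin (d + 1)) (A × B × Fin (d + 1)) ℂ),
      IsQuantumOperation W ∧
        p = G.winProb (applyOn (registersABE A B C (Fin (d + 1))) W (G.initialState d))},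
      p ≤ t ^ 2 := by
    rintro p ⟨d, W, hW, rfl⟩
    obtain ⟨N, L, rfl, hL⟩ := hW.exists_kraus
    rw [winProb_krausMap, ← Fintype.sum_prod_type']
    exact sum_norm_trace_mul_sq_le h hP hQ (sum_jointBlock hL)
  refine le_antisymm (Real.sSup_le hub (sq_nonneg t)) (hKt.trans (le_csSup ⟨_, hub⟩ ?_))
  -- A one-dimensional auxiliary space (`d = 0`) suffices for the optimal strategy.
  let e : A × B × Fin 1 ≃ A × B :=
    { toFun := fun x => (x.1, x.2.1)
      invFun := fun x => (x.1, x.2, 0)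
      left_inv := fun x => by ext <;> simp
      right_inv := fun _ => rfl }
  refine ⟨0, krausMap fun i => (K i).submatrix e e, isQuantumOperation_krausMap ?_, ?_⟩
  · simp_rw [conjTranspose_submatrix, submatrix_mul_equiv]
    have := congrArg (fun X => X.submatrix e e) hK
    simp only [submatrix_one_equiv] at this
    rw [← this]
    ext x y
    simp [Matrix.sum_apply]
  · rw [winProb_krausMap]
    simp only [Nat.reduceAdd, Finset.univ_unique, Finset.sum_singleton]
    rfl

/-- The game matrix of `G^k` is the tensor power of that of `G`, with the registers regrouped. -/
theorem gameMatrix_parallel [DecidableEq C] (k : ℕ) :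
    (G.parallel k).gameMatrix = (tensorMatrix fun _ : Fin k => G.gameMatrix).submatrix
      (Equiv.arrowProdEquivProdArrow (Fin k) (fun _ => A) fun _ => B).symm
      (Equiv.arrowProdEquivProdArrow (Fin k) (fun _ => A) fun _ => B).symm := by
  ext ⟨f, g⟩ ⟨f', g'⟩
  simp only [gameMatrix, parallel, tensorMatrix_apply, submatrix_apply, Matrix.of_apply, ketBra,
    vecMulVec_apply, tensorPower, Equiv.arrowProdEquivProdArrow, Equiv.coe_fn_symm_mk,
    Finset.prod_univ_sum, Fintype.piFinset_univ, star_prod, Finset.prod_mul_distrib]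

theorem maximalValue_eq_traceNorm [DecidableEq A] [DecidableEq B] :
    G.maximalValue = traceNorm G.gameMatrix ^ 2 := by
  obtain ⟨P, Q, h, hP, hQ⟩ := exists_posSemidef_fromBlocks_traceNorm G.gameMatrix
  obtain ⟨K, hK, hKt⟩ := exists_kraus_traceNorm_le G.gameMatrix
  exact G.maximalValue_eq_sq h hP hQ hK hKt

theorem maximalValue_parallel [DecidableEq A] [DecidableEq B] (k : ℕ) :
    (G.parallel k).maximalValue = G.maximalValue ^ k := by
  classical
  obtain ⟨P, Q, h, hP, hQ⟩ := exists_posSemidef_fromBlocks_traceNorm G.gameMatrix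
  obtain ⟨K, hK, hKt⟩ := exists_kraus_traceNorm_le G.gameMatrix
  rw [G.maximalValue_eq_traceNorm, ← pow_mul, mul_comm, pow_mul]
  let e := (Equiv.arrowProdEquivProdArrow (Fin k) (fun _ => A) fun _ => B).symm
  refine maximalValue_eq_sq (P := (tensorMatrix fun _ : Fin k => P).submatrix e e)
    (Q := (tensorMatrix fun _ : Fin k => Q).submatrix e e)
    (K := fun ε : Fin k → Fin 2 => (tensorMatrix fun i => K (ε i)).submatrix e e) _ ?_ ?_ ?_ ?_ ?_
  · rw [gameMatrix_parallel]
    -- The k-th tensor power of the certificate has 2^k block types; the principal submatrix on the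
    -- all-left and all-right indices is the certificate for M^{⊗k}.
    have := (Matrix.PosSemidef.tensorMatrix fun _ : Fin k => h).submatrix
      (Sum.elim (fun x i => Sum.inl (e x i)) fun x i => Sum.inr (e x i))
    convert this using 1
    ext (x | x) (y | y) <;> simp [tensorMatrix_apply, e]
  · rw [trace_submatrix_equiv, trace_tensorMatrix, hP]
    simp
  · rw [trace_submatrix_equiv, trace_tensorMatrix, hQ]
    simp
  · simp_rw [conjTranspose_submatrix, submatrix_mul_equiv, tensorMatrix_conjTranspose,
      tensorMatrix_mul]
    have := congrArg (fun X => X.submatrix e e)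
      (sum_tensorMatrix (k := k) fun i => (K i)ᴴ * K i)
    simp only [hK, tensorMatrix_one, submatrix_one_equiv] at this
    rw [← this]
    ext x y
    simp [Matrix.sum_apply]
  · simp_rw [gameMatrix_parallel, e, submatrix_mul_equiv, trace_submatrix_equiv, tensorMatrix_mul,
      trace_tensorMatrix, norm_prod, ← Finset.prod_pow]
    rw [← pow_mul, mul_comm, pow_mul]
    refine (pow_le_pow_left₀ (sq_nonneg _) hKt k).trans (le_of_eq ?_)
    exact Fintype.sum_pow _ _

end RankOneGame

/-! ### Duality for the value with one-way communication -/

section oneWayDuality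

open Matrix

variable {A B : Type*} [Fintype A] [Fintype B]

/-- The values `|∑ e, tr (M (V e ⊗ R e))|` for a column contraction `V` and a row contraction `R`. -/
def amplitudes [DecidableEq A] [DecidableEq B] (M : Matrix (A × B) (A × B) ℂ) : Set ℝ :=
  {p | ∃ (d : ℕ) (V : Fin (d + 1) → Matrix A A ℂ) (R : Fin (d + 1) → Matrix B B ℂ),
    ∑ e, (V e)ᴴ * V e = 1 ∧ ∑ e, R e * (R e)ᴴ = 1 ∧ p = ‖∑ e, (M * (V e ⊗ₖ R e)).trace‖}

theorem mem_amplitudes [DecidableEq A] [DecidableEq B] [Nonempty A]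
    (M : Matrix (A × B) (A × B) ℂ) {ι : Type*} [Fintype ι]
    {V : ι → Matrix A A ℂ} {R : ι → Matrix B B ℂ} (hV : ∑ e, (V e)ᴴ * V e = 1)
    (hR : ∑ e, R e * (R e)ᴴ = 1) : ‖∑ e, (M * (V e ⊗ₖ R e)).trace‖ ∈ amplitudes M := by
  have hι : Fintype.card ι ≠ 0 := by
    intro h0
    have := Fintype.card_eq_zero_iff.1 h0
    rw [Finset.univ_eq_empty, Finset.sum_empty] at hV
    exact zero_ne_one hV
  obtain ⟨d, hd⟩ := Nat.exists_eq_succ_of_ne_zero hι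
  let φ := Fintype.equivFinOfCardEq hd
  refine ⟨d, fun e => V (φ.symm e), fun e => R (φ.symm e), ?_, ?_, ?_⟩
  · rw [← hV]
    exact φ.symm.sum_comp fun e => (V e)ᴴ * V e
  · rw [← hR]
    exact φ.symm.sum_comp fun e => R e * (R e)ᴴ
  · rw [← φ.symm.sum_comp]

/-- The coefficients of the bilinear form `(V, R) ↦ tr (M (V ⊗ R))`. -/
def realign (M : Matrix (A × B) (A × B) ℂ) : Matrix (A × A) (B × B) ℂ :=
  Matrix.of fun p q => M (p.2, q.2) (p.1, q.1)

theorem trace_mul_kronecker (M : Matrix (A × B) (A × B) ℂ) (V : Matrix A A ℂ)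
    (R : Matrix B B ℂ) :
    (M * (V ⊗ₖ R)).trace = ∑ p : A × A, ∑ q : B × B, V p.1 p.2 * realign M p q * R q.1 q.2 := by
  rw [trace_mul_comm]
  simp only [Matrix.trace, Matrix.diag, Matrix.mul_apply, Fintype.sum_prod_type,
    Matrix.kroneckerMap_apply, realign, Matrix.of_apply]
  refine Finset.sum_congr rfl fun a _ => ?_
  rw [Finset.sum_comm]
  refine Finset.sum_congr rfl fun a' _ => Finset.sum_congr rfl fun b _ =>
    Finset.sum_congr rfl fun b' _ => ?_
  ring

/-- A crude entrywise estimate, independent of the number of terms; it serves only to make the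
supremum of the amplitudes finite. -/
theorem norm_trace_mul_kronecker_le [DecidableEq A] [DecidableEq B]
    (M : Matrix (A × B) (A × B) ℂ) {ι : Type*} [Fintype ι]
    {V : ι → Matrix A A ℂ} {R : ι → Matrix B B ℂ} (hV : ∑ e, (V e)ᴴ * V e = 1)
    (hR : ∑ e, R e * (R e)ᴴ = 1) :
    ‖∑ e, (M * (V e ⊗ₖ R e)).trace‖ ≤ ∑ p, ∑ q, ‖realign M p q‖ := by
  have hV1 : ∀ p : A × A, ∑ e, ‖V e p.1 p.2‖ ^ 2 ≤ 1 := by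
    intro p
    have h := congrFun (congrFun hV p.2) p.2
    simp only [Matrix.sum_apply, Matrix.mul_apply, conjTranspose_apply, RCLike.star_def,
      Complex.conj_mul', Matrix.one_apply_eq] at h
    have h' : ∑ e, ∑ a, ‖V e a p.2‖ ^ 2 = 1 := by exact_mod_cast h
    rw [← h']
    exact Finset.sum_le_sum fun e _ => Finset.single_le_sum (f := fun a => ‖V e a p.2‖ ^ 2)
      (fun _ _ => by positivity) (Finset.mem_univ _)
  have hR1 : ∀ q : B × B, ∑ e, ‖R e q.1 q.2‖ ^ 2 ≤ 1 := by
    intro q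
    have h := congrFun (congrFun hR q.1) q.1
    simp only [Matrix.sum_apply, Matrix.mul_apply, conjTranspose_apply, RCLike.star_def,
      Complex.mul_conj', Matrix.one_apply_eq] at h
    have h' : ∑ e, ∑ b, ‖R e q.1 b‖ ^ 2 = 1 := by exact_mod_cast h
    rw [← h']
    exact Finset.sum_le_sum fun e _ => Finset.single_le_sum (f := fun b => ‖R e q.1 b‖ ^ 2)
      (fun _ _ => by positivity) (Finset.mem_univ _)
  simp_rw [trace_mul_kronecker]
  rw [Finset.sum_comm]
  refine (norm_sum_le _ _).trans (Finset.sum_le_sum fun p _ => ?_)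
  rw [Finset.sum_comm]
  refine (norm_sum_le _ _).trans (Finset.sum_le_sum fun q _ => ?_)
  have : ∑ e, V e p.1 p.2 * realign M p q * R e q.1 q.2 =
      (∑ e, V e p.1 p.2 * R e q.1 q.2) * realign M p q := by
    rw [Finset.sum_mul]
    exact Finset.sum_congr rfl fun e _ => by ring
  rw [this, norm_mul]
  refine mul_le_of_le_one_left (norm_nonneg _) ?_
  rw [← sq_le_one_iff₀ (norm_nonneg _)]
  refine (norm_sum_mul_sq_le _ _ _).trans ?_
  exact mul_le_one₀ (hV1 p) (by positivity) (hR1 q)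

theorem bddAbove_amplitudes [DecidableEq A] [DecidableEq B] (M : Matrix (A × B) (A × B) ℂ) :
    BddAbove (amplitudes M) := by
  refine ⟨∑ p, ∑ q, ‖realign M p q‖, ?_⟩
  rintro p ⟨d, V, R, hV, hR, rfl⟩
  exact norm_trace_mul_kronecker_le M hV hR

/-- Positivity of this matrix says that the form `(V, R) ↦ tr (M (V ⊗ R))` is bounded by `t` on
the Hilbert spaces with the norms `tr (V ρ Vᴴ)` and `tr (Rᴴ σ R)`. -/
def dualMatrix [DecidableEq A] [DecidableEq B] (M : Matrix (A × B) (A × B) ℂ) (t : ℝ)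
    (ρ : Matrix A A ℂ) (σ : Matrix B B ℂ) : Matrix (A × A ⊕ B × B) (A × A ⊕ B × B) ℂ :=
  fromBlocks (t • ((1 : Matrix A A ℂ) ⊗ₖ ρ)) (realign M) (realign M)ᴴ
    (t • (σ ⊗ₖ (1 : Matrix B B ℂ)))

theorem dualMatrix_isHermitian {A B : Type*} [DecidableEq A] [DecidableEq B]
    (M : Matrix (A × B) (A × B) ℂ)
    (t : ℝ) {ρ : Matrix A A ℂ} {σ : Matrix B B ℂ} (hρ : ρ.IsHermitian) (hσ : σ.IsHermitian) :
    (dualMatrix M t ρ σ).IsHermitian := by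
  refine Matrix.IsHermitian.fromBlocks ?_ rfl ?_
  · rw [IsHermitian, conjTranspose_smul, conjTranspose_kronecker, hρ.eq]
    simp
  · rw [IsHermitian, conjTranspose_smul, conjTranspose_kronecker, hσ.eq]
    simp

theorem dotProduct_dualMatrix [DecidableEq A] [DecidableEq B] (M : Matrix (A × B) (A × B) ℂ)
    (t : ℝ) (ρ : Matrix A A ℂ) (σ : Matrix B B ℂ) (V : Matrix A A ℂ) (R : Matrix B B ℂ) :
    star (Sum.elim (fun p : A × A => star (V p.1 p.2)) fun q : B × B => R q.1 q.2) ⬝ᵥ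
      (dualMatrix M t ρ σ *ᵥ
        Sum.elim (fun p : A × A => star (V p.1 p.2)) fun q : B × B => R q.1 q.2) =
      t * (V * ρ * Vᴴ).trace + t * (Rᴴ * σ * R).trace +
        ((M * (V ⊗ₖ R)).trace + star (M * (V ⊗ₖ R)).trace) := by
  have h1 : (V * ρ * Vᴴ).trace = ∑ p : A × A, V p.1 p.2 * ∑ a, ρ p.2 a * star (V p.1 a) := by
    rw [Matrix.mul_assoc]
    simp only [Matrix.trace, Matrix.diag, Matrix.mul_apply, Fintype.sum_prod_type,
      conjTranspose_apply]
  have h2 : (Rᴴ * σ * R).trace = ∑ q : B × B, star (R q.1 q.2) * ∑ b, σ q.1 b * R b q.2 := by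
    rw [Matrix.mul_assoc]
    simp only [Matrix.trace, Matrix.diag, Matrix.mul_apply, Fintype.sum_prod_type,
      conjTranspose_apply]
    rw [Finset.sum_comm]
  have h3 : star (M * (V ⊗ₖ R)).trace = ∑ q : B × B, ∑ p : A × A,
      star (R q.1 q.2) * star (realign M p q) * star (V p.1 p.2) := by
    rw [trace_mul_kronecker, star_sum, Finset.sum_comm]
    simp only [star_sum, star_mul']
    refine Finset.sum_congr rfl fun q _ => Finset.sum_congr rfl fun p _ => by ring
  rw [h1, h2, h3, trace_mul_kronecker]
  simp only [dualMatrix, dotProduct, mulVec, Fintype.sum_sum_type, Pi.star_apply, Sum.elim_inl,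
    Sum.elim_inr, fromBlocks_apply₁₁, fromBlocks_apply₁₂, fromBlocks_apply₂₁, fromBlocks_apply₂₂,
    mul_add, Finset.sum_add_distrib, star_star, conjTranspose_apply, Finset.mul_sum]
  have e1 : ∀ p : A × A, ∑ x : A × A, V p.1 p.2 * ((t • ((1 : Matrix A A ℂ) ⊗ₖ ρ)) p x *
      star (V x.1 x.2)) = ∑ a, t * (V p.1 p.2 * (ρ p.2 a * star (V p.1 a))) := by
    intro p
    rw [Fintype.sum_prod_type, Finset.sum_eq_single p.1]
    · refine Finset.sum_congr rfl fun a _ => ?_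
      simp
      ring
    · intro a _ ha
      simp [ha.symm]
    · simp
  have e2 : ∀ p : B × B, ∑ x : B × B, star (R p.1 p.2) * ((t • (σ ⊗ₖ (1 : Matrix B B ℂ))) p x *
      R x.1 x.2) = ∑ b, t * (star (R p.1 p.2) * (σ p.1 b * R b p.2)) := by
    intro p
    rw [Fintype.sum_prod_type_right, Finset.sum_eq_single p.2]
    · refine Finset.sum_congr rfl fun a _ => ?_
      simp
      ring
    · intro a _ ha
      simp [ha.symm]
    · simp
  simp_rw [e1, e2, mul_assoc]
  ring

/-- No normalisation of R is imposed, so R may later absorb the coefficients of a linear combination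
of Bob's outcomes. -/
theorem norm_sum_trace_sq_le_of_dualMatrix [DecidableEq A] [DecidableEq B]
    {M : Matrix (A × B) (A × B) ℂ} {t : ℝ} {ρ : Matrix A A ℂ} {σ : Matrix B B ℂ}
    (hZ : (dualMatrix M t ρ σ).PosSemidef) (hρ : ρ.trace = 1) (hσ : σ.PosSemidef) {ι : Type*} [Fintype ι]
    {V : ι → Matrix A A ℂ} (R : ι → Matrix B B ℂ) (hV : ∑ e, (V e)ᴴ * V e = 1) :
    ‖∑ e, (M * (V e ⊗ₖ R e)).trace‖ ^ 2 ≤ t ^ 2 * (∑ e, ((R e)ᴴ * σ * R e).trace).re := by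
  set z := ∑ e, (M * (V e ⊗ₖ R e)).trace with hz
  set b := (∑ e, ((R e)ᴴ * σ * R e).trace).re with hb
  have hVρ : ∑ e, (V e * ρ * (V e)ᴴ).trace = 1 := by
    simp_rw [trace_mul_cycle (V _) ρ]
    rw [← trace_sum, ← Finset.sum_mul, hV, one_mul, hρ]
  have hb0 : 0 ≤ b := by
    rw [hb, Complex.re_sum]
    exact Finset.sum_nonneg fun e _ =>
      (Complex.nonneg_iff.1 (hσ.conjTranspose_mul_mul_same (R e)).trace_nonneg).1
  -- The quadratic form is evaluated at (V_e, s z̄ R_e): the phase z̄ makes the cross term real, and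
  -- the discriminant in s then gives the bound.
  have key : ∀ s : ℝ, 0 ≤ t + t * (s ^ 2 * ‖z‖ ^ 2 * b) + 2 * (s * ‖z‖ ^ 2) := by
    intro s
    have h := Finset.sum_nonneg fun e (_ : e ∈ Finset.univ) => hZ.dotProduct_mulVec_nonneg
      (Sum.elim (fun p : A × A => star (V e p.1 p.2))
        fun q : B × B => (((s : ℂ) * star z) • R e) q.1 q.2)
    simp only [dotProduct_dualMatrix, Finset.sum_add_distrib, ← Finset.mul_sum, hVρ,
      conjTranspose_smul, Matrix.smul_mul, Matrix.mul_smul, smul_smul, trace_smul, smul_eq_mul,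
      kronecker_smul, ← star_sum, ← hz] at h
    have h' := (Complex.nonneg_iff.1 h).1
    have hzz : (s : ℂ) * star z * z = ((s * ‖z‖ ^ 2 : ℝ) : ℂ) := by
      push_cast
      rw [mul_assoc, RCLike.star_def, Complex.conj_mul']
    have hzz' : (s : ℂ) * star z * star ((s : ℂ) * star z) = ((s ^ 2 * ‖z‖ ^ 2 : ℝ) : ℂ) := by
      rw [RCLike.star_def, Complex.mul_conj', norm_mul, Complex.norm_conj,
        Complex.norm_real, Real.norm_eq_abs]
      push_cast
      rw [mul_pow, ← Complex.ofReal_pow, sq_abs]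
      push_cast
      rfl
    rw [hzz, hzz'] at h'
    simpa [Complex.re_ofReal_mul, ← hb, two_mul, ← Complex.ofReal_pow] using h'
  have hd := discrim_le_zero (a := t * (‖z‖ ^ 2 * b)) (b := 2 * ‖z‖ ^ 2) (c := t)
    fun s => (key s).trans_eq (by ring)
  rw [discrim] at hd
  by_contra! hlt
  have hz0 : 0 < ‖z‖ ^ 2 := by
    rw [sq_pos_iff]
    intro h0
    rw [h0] at hlt
    nlinarith [mul_nonneg (sq_nonneg t) hb0]
  nlinarith

end oneWayDuality

/-! ### Existence of the dual states by minimax. -/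

section strongDuality

open Matrix

variable {A B : Type*} [Fintype A] [Fintype B] [DecidableEq A] [DecidableEq B]

/-- A bound on the amplitudes extends to families that are not normalized. -/
theorem norm_sum_trace_le_of_amplitudes_le [Nonempty A] {M : Matrix (A × B) (A × B) ℂ} {t : ℝ}
    (ht : ∀ p ∈ amplitudes M, p ≤ t) {ι : Type*} [Fintype ι] {V : ι → Matrix A A ℂ}
    {R : ι → Matrix B B ℂ} {c d : ℝ} (hc : 0 < c) (hd : 0 < d)
    (hV : (c ^ 2 • (1 : Matrix A A ℂ) - ∑ e, (V e)ᴴ * V e).PosSemidef)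
    (hR : (d ^ 2 • (1 : Matrix B B ℂ) - ∑ e, R e * (R e)ᴴ).PosSemidef) :
    ‖∑ e, (M * (V e ⊗ₖ R e)).trace‖ ≤ t * (c * d) := by
  obtain ⟨S, hS⟩ := hV.exists_eq_conjTranspose_mul_self
  obtain ⟨S', hS'⟩ := hR.exists_eq_conjTranspose_mul_self
  -- The two `Bool` slots complete the rescaled families to exact normalisation. The defect of V is
  -- paired with 0 in R and conversely, so the padding leaves the amplitude sum unaffected.
  have h1 : ∑ e : ι ⊕ Bool, (Sum.elim (fun e => c⁻¹ • V e)
      (fun b => if b then c⁻¹ • S else 0) e)ᴴ * (Sum.elim (fun e => c⁻¹ • V e)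
      (fun b => if b then c⁻¹ • S else 0) e) = 1 := by
    simp only [Fintype.sum_sum_type, Sum.elim_inl, Sum.elim_inr, Fintype.sum_bool, if_true,
      Bool.false_eq_true, if_false, conjTranspose_smul, star_trivial, Matrix.smul_mul,
      Matrix.mul_smul, smul_smul, conjTranspose_zero, Matrix.zero_mul, add_zero]
    rw [← Finset.smul_sum, ← smul_add, ← hS, add_sub_cancel, smul_smul, ← sq, ← mul_pow,
      inv_mul_cancel₀ hc.ne', one_pow, one_smul]
  have h2 : ∑ e : ι ⊕ Bool, (Sum.elim (fun e => d⁻¹ • R e)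
      (fun b => if b then 0 else d⁻¹ • S'ᴴ) e) * (Sum.elim (fun e => d⁻¹ • R e)
      (fun b => if b then 0 else d⁻¹ • S'ᴴ) e)ᴴ = 1 := by
    simp only [Fintype.sum_sum_type, Sum.elim_inl, Sum.elim_inr, Fintype.sum_bool, if_true,
      Bool.false_eq_true, if_false, conjTranspose_smul, star_trivial, Matrix.smul_mul,
      Matrix.mul_smul, smul_smul, Matrix.zero_mul, zero_add, conjTranspose_conjTranspose]
    rw [← Finset.smul_sum, ← smul_add, ← hS', add_sub_cancel, smul_smul, ← sq, ← mul_pow,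
      inv_mul_cancel₀ hd.ne', one_pow, one_smul]
  have h := ht _ (mem_amplitudes M h1 h2)
  simp only [Fintype.sum_sum_type, Sum.elim_inl, Sum.elim_inr, Fintype.sum_bool, if_true,
    Bool.false_eq_true, if_false, kronecker_zero, zero_kronecker, Matrix.mul_zero, trace_zero,
    add_zero, smul_zero, smul_kronecker, kronecker_smul, smul_smul, Matrix.mul_smul, trace_smul,
    ← Finset.smul_sum] at h
  rw [norm_smul, Real.norm_eq_abs, abs_of_pos (by positivity), ← mul_inv, inv_mul_le_iff₀ (by positivity)] at h
  linarith

theorem dualMatrix_combo {A B : Type*} [DecidableEq A] [DecidableEq B]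
    (M : Matrix (A × B) (A × B) ℂ) (t : ℝ) (ρ ρ' : Matrix A A ℂ)
    (σ σ' : Matrix B B ℂ) {a b : ℝ} (hab : a + b = 1) :
    dualMatrix M t (a • ρ + b • ρ') (a • σ + b • σ') =
      a • dualMatrix M t ρ σ + b • dualMatrix M t ρ' σ' := by
  rw [dualMatrix, dualMatrix, dualMatrix, fromBlocks_smul, fromBlocks_smul, fromBlocks_add,
    ← add_smul, ← add_smul, hab, one_smul, one_smul, kronecker_add, add_kronecker, kronecker_smul,
    kronecker_smul, smul_kronecker, smul_kronecker, smul_add, smul_add, smul_comm t a,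
    smul_comm t b, smul_comm t a, smul_comm t b]

theorem continuous_dualMatrix {A B : Type*} [DecidableEq A] [DecidableEq B]
    (M : Matrix (A × B) (A × B) ℂ) (t : ℝ) :
    Continuous fun x : Matrix A A ℂ × Matrix B B ℂ => dualMatrix M t x.1 x.2 := by
  refine continuous_matrix fun i j => ?_
  rcases i with i | i <;> rcases j with j | j <;>
    simp only [dualMatrix, fromBlocks_apply₁₁, fromBlocks_apply₁₂, fromBlocks_apply₂₁,
      fromBlocks_apply₂₂, Matrix.smul_apply, kroneckerMap_apply] <;> fun_prop

/-- For a fixed test matrix Γ, take ρ and σ to be top eigenstates of ∑ Vᴴ V and ∑ R Rᴴ, with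
eigenvalues α and β. The trace is t α + t β + 2 Re z, and the amplitude bound gives |z| ≤ t √(αβ) ≤
t (α + β)/2. -/
theorem exists_densityMatrix_trace_dualMatrix_nonneg [Nonempty A] [Nonempty B]
    {M : Matrix (A × B) (A × B) ℂ} {t : ℝ} (ht0 : 0 ≤ t) (ht : ∀ p ∈ amplitudes M, p ≤ t)
    {Γ : Matrix (A × A ⊕ B × B) (A × A ⊕ B × B) ℂ} (hΓ : Γ.PosSemidef) :
    ∃ ρ ∈ densityMatrices A, ∃ σ ∈ densityMatrices B,
      0 ≤ (dualMatrix M t ρ σ * Γ).trace.re := by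
  obtain ⟨L, rfl⟩ := hΓ.exists_eq_conjTranspose_mul_self
  -- Each row of L is read as a pair (V_l, R_l), so that tr (Z Lᴴ L), with Z the dual matrix, is the
  -- sum of its quadratic forms at these pairs.
  let V : (A × A ⊕ B × B) → Matrix A A ℂ := fun l => Matrix.of fun a a' => L l (Sum.inl (a, a'))
  let R : (A × A ⊕ B × B) → Matrix B B ℂ :=
    fun l => Matrix.of fun b b' => star (L l (Sum.inr (b, b')))
  have hX : (∑ l, (V l)ᴴ * V l).PosSemidef :=
    posSemidef_sum _ fun l _ => posSemidef_conjTranspose_mul_self _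
  have hY : (∑ l, R l * (R l)ᴴ).PosSemidef :=
    posSemidef_sum _ fun l _ => posSemidef_self_mul_conjTranspose _
  obtain ⟨ρ, hρ, hρX⟩ := hX.1.exists_densityMatrix_max
  obtain ⟨σ, hσ, hσY⟩ := hY.1.exists_densityMatrix_max
  refine ⟨ρ, hρ, σ, hσ, ?_⟩
  set α := (ρ * ∑ l, (V l)ᴴ * V l).trace.re with hα
  set β := (σ * ∑ l, R l * (R l)ᴴ).trace.re with hβ
  set z := ∑ l, (M * (V l ⊗ₖ R l)).trace with hz
  have hα0 : 0 ≤ α := (Complex.nonneg_iff.1 (hρ.1.trace_mul_nonneg hX)).1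
  have hβ0 : 0 ≤ β := (Complex.nonneg_iff.1 (hσ.1.trace_mul_nonneg hY)).1
  have htrace : (dualMatrix M t ρ σ * (Lᴴ * L)).trace.re = t * α + t * β + 2 * z.re := by
    have hquad : (dualMatrix M t ρ σ * (Lᴴ * L)).trace = ∑ l,
        (t * (V l * ρ * (V l)ᴴ).trace + t * ((R l)ᴴ * σ * R l).trace +
          ((M * (V l ⊗ₖ R l)).trace + star (M * (V l ⊗ₖ R l)).trace)) := by
      simp_rw [← dotProduct_dualMatrix]
      rw [← Matrix.mul_assoc, trace_mul_comm, ← Matrix.mul_assoc, Matrix.mul_assoc]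
      simp only [Matrix.trace, Matrix.diag]
      refine Finset.sum_congr rfl fun l _ => ?_
      have hvec : (Sum.elim (fun p : A × A => star (V l p.1 p.2))
          fun q : B × B => R l q.1 q.2) = star (L l) := by
        ext (p | p) <;> rfl
      rw [hvec, star_star]
      rfl
    rw [hquad]
    simp_rw [trace_mul_cycle (V _) ρ, trace_mul_cycle (R _)ᴴ σ]
    rw [Finset.sum_add_distrib, Finset.sum_add_distrib, Finset.sum_add_distrib, ← Finset.mul_sum,
      ← Finset.mul_sum, ← trace_sum, ← trace_sum, ← Finset.sum_mul, ← Finset.sum_mul, ← star_sum,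
      ← hz, trace_mul_comm _ ρ, trace_mul_comm _ σ]
    simp only [Complex.add_re, Complex.re_ofReal_mul, RCLike.star_def, Complex.conj_re, ← hα, ← hβ,
      two_mul]
  rw [htrace]
  -- The shift by ε covers α = 0 or β = 0, where the families cannot be rescaled.
  have hbound : ∀ ε > 0, ‖z‖ ≤ t * ((α + β) / 2) + t * ε := by
    intro ε hε
    have hsα : √(α + ε) ^ 2 = α + ε := Real.sq_sqrt (by positivity)
    have hsβ : √(β + ε) ^ 2 = β + ε := Real.sq_sqrt (by positivity)
    have hV : (√(α + ε) ^ 2 • (1 : Matrix A A ℂ) - ∑ e, (V e)ᴴ * V e).PosSemidef := by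
      rw [hsα, add_smul, add_sub_right_comm]
      exact hρX.add (PosSemidef.one.smul hε.le)
    have hR : (√(β + ε) ^ 2 • (1 : Matrix B B ℂ) - ∑ e, R e * (R e)ᴴ).PosSemidef := by
      rw [hsβ, add_smul, add_sub_right_comm]
      exact hσY.add (PosSemidef.one.smul hε.le)
    refine (norm_sum_trace_le_of_amplitudes_le ht (by positivity) (by positivity) hV hR).trans ?_
    rw [← mul_add]
    gcongr
    nlinarith [sq_nonneg (√(α + ε) - √(β + ε))]
  have hle : ‖z‖ ≤ t * ((α + β) / 2) := by
    refine le_of_forall_pos_le_add fun δ hδ => ?_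
    refine (hbound (δ / (t + 1)) (by positivity)).trans ?_
    gcongr
    rw [mul_div_assoc', div_le_iff₀ (by positivity)]
    nlinarith
  have := (abs_le.1 ((Complex.abs_re_le_norm z).trans hle)).1
  linarith

theorem exists_posSemidef_dualMatrix [Nonempty A] [Nonempty B]
    {M : Matrix (A × B) (A × B) ℂ} {t : ℝ} (ht0 : 0 ≤ t) (ht : ∀ p ∈ amplitudes M, p ≤ t) :
    ∃ ρ ∈ densityMatrices A, ∃ σ ∈ densityMatrices B, (dualMatrix M t ρ σ).PosSemidef := by
  let f : Matrix (A × A ⊕ B × B) (A × A ⊕ B × B) ℂ → Matrix A A ℂ × Matrix B B ℂ → ℝ :=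
    fun Γ x => (dualMatrix M t x.1 x.2 * Γ).trace.re
  have hcΓ : ∀ x, Continuous fun Γ => f Γ x := fun x => by
    simp only [f]
    fun_prop
  have hcx : ∀ Γ, Continuous fun x => f Γ x := fun Γ => by
    have := continuous_dualMatrix M t
    simp only [f]
    fun_prop
  have hY : Convex ℝ (densityMatrices A ×ˢ densityMatrices B) :=
    (convex_densityMatrices A).prod (convex_densityMatrices B)
  obtain ⟨Γ, hΓ, ⟨ρ, σ⟩, hρσ, hsaddle⟩ := Sion.exists_isSaddlePointOn (f := f)
    (nonempty_densityMatrices _) (convex_densityMatrices _) (isCompact_densityMatrices _)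
    (fun x _ => (hcΓ x).lowerSemicontinuous.lowerSemicontinuousOn _)
    (fun x _ => ConvexOn.quasiconvexOn ⟨convex_densityMatrices _, by
      intro Γ _ Γ' _ a b _ _ _
      simp [f, Matrix.mul_add]⟩)
    hY ((nonempty_densityMatrices A).prod (nonempty_densityMatrices B))
    ((isCompact_densityMatrices A).prod (isCompact_densityMatrices B))
    (fun Γ _ => (hcx Γ).upperSemicontinuous.upperSemicontinuousOn _)
    (fun Γ _ => ConcaveOn.quasiconcaveOn ⟨hY, by
      intro x _ y _ a b _ _ hab
      simp only [f, Prod.fst_add, Prod.snd_add, Prod.smul_fst, Prod.smul_snd,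
        dualMatrix_combo M t _ _ _ _ hab]
      simp [Matrix.add_mul]⟩)
  obtain ⟨ρ', hρ', σ', hσ', hnn⟩ := exists_densityMatrix_trace_dualMatrix_nonneg ht0 ht hΓ.1
  refine ⟨ρ, hρσ.1, σ, hρσ.2, PosSemidef.of_dotProduct_mulVec_nonneg
    (dualMatrix_isHermitian M t hρσ.1.1.1 hρσ.2.1.1) fun x => ?_⟩
  have hH := dualMatrix_isHermitian M t hρσ.1.1.1 hρσ.2.1.1
  refine Complex.nonneg_iff.2 ⟨?_, (hH.im_star_dotProduct_mulVec_self x).symm⟩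
  obtain rfl | hx := eq_or_ne x 0
  · simp
  obtain ⟨s, hs0, -, hmem⟩ := exists_smul_vecMulVec_mem_densityMatrices hx
  -- The states ρ', σ' depend on the saddle Γ; the saddle inequality transfers nonnegativity to the
  -- fixed pair (ρ, σ) against every test state, here the pure state of x.
  have h := hnn.trans (hsaddle _ hmem (ρ', σ') ⟨hρ', hσ'⟩)
  simp only [f, Matrix.mul_smul, trace_smul, mul_vecMulVec, trace_vecMulVec, Complex.smul_re,
    smul_eq_mul] at h
  rw [dotProduct_comm] at h
  exact nonneg_of_mul_nonneg_right h (inv_pos.2 hs0)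

end strongDuality

/-! ### The value with one-way communication -/

open Matrix

/-! ### Tensor powers of one-way strategies and certificates. -/

section tensorPowers

variable {A B : Type*} [Fintype A] [Fintype B] [DecidableEq A] [DecidableEq B]

theorem pow_mem_amplitudes [Nonempty A] {M : Matrix (A × B) (A × B) ℂ} {p : ℝ}
    (hp : p ∈ amplitudes M) (k : ℕ) :
    p ^ k ∈ amplitudes ((tensorMatrix fun _ : Fin k => M).submatrix
      (Equiv.arrowProdEquivProdArrow (Fin k) (fun _ => A) fun _ => B).symm
      (Equiv.arrowProdEquivProdArrow (Fin k) (fun _ => A) fun _ => B).symm) := by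
  obtain ⟨d, V, R, hV, hR, rfl⟩ := hp
  have hV' : ∑ ε : Fin k → Fin (d + 1), (tensorMatrix fun i => V (ε i))ᴴ *
      (tensorMatrix fun i => V (ε i)) = 1 := by
    simp_rw [tensorMatrix_conjTranspose, tensorMatrix_mul]
    rw [sum_tensorMatrix fun e => (V e)ᴴ * V e, hV, tensorMatrix_one]
  have hR' : ∑ ε : Fin k → Fin (d + 1), (tensorMatrix fun i => R (ε i)) *
      (tensorMatrix fun i => R (ε i))ᴴ = 1 := by
    simp_rw [tensorMatrix_conjTranspose, tensorMatrix_mul]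
    rw [sum_tensorMatrix fun e => R e * (R e)ᴴ, hR, tensorMatrix_one]
  convert mem_amplitudes _ hV' hR' using 1
  have hkr : ∀ ε : Fin k → Fin (d + 1),
      (tensorMatrix fun i => V (ε i)) ⊗ₖ (tensorMatrix fun i => R (ε i)) =
      (tensorMatrix fun i => V (ε i) ⊗ₖ R (ε i)).submatrix
        (Equiv.arrowProdEquivProdArrow (Fin k) (fun _ => A) fun _ => B).symm
        (Equiv.arrowProdEquivProdArrow (Fin k) (fun _ => A) fun _ => B).symm := by
    intro ε
    ext x y
    simp [tensorMatrix_apply, Finset.prod_mul_distrib, Equiv.arrowProdEquivProdArrow]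
  simp_rw [hkr, submatrix_mul_equiv, trace_submatrix_equiv, tensorMatrix_mul, trace_tensorMatrix]
  rw [← norm_pow]
  congr 1
  exact Fintype.sum_pow (fun e => (M * (V e ⊗ₖ R e)).trace) k

theorem tensorMatrix_mem_densityMatrices {n : Type*} [Fintype n] {ρ : Matrix n n ℂ}
    (hρ : ρ ∈ densityMatrices n) (k : ℕ) :
    tensorMatrix (fun _ : Fin k => ρ) ∈ densityMatrices (Fin k → n) := by
  classical
  refine ⟨PosSemidef.tensorMatrix fun _ => hρ.1, ?_⟩
  rw [trace_tensorMatrix, hρ.2, Finset.prod_const_one]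

theorem posSemidef_dualMatrix_tensorMatrix {M : Matrix (A × B) (A × B) ℂ} {t : ℝ}
    {ρ : Matrix A A ℂ} {σ : Matrix B B ℂ} (h : (dualMatrix M t ρ σ).PosSemidef) (k : ℕ) :
    (dualMatrix ((tensorMatrix fun _ : Fin k => M).submatrix
      (Equiv.arrowProdEquivProdArrow (Fin k) (fun _ => A) fun _ => B).symm
      (Equiv.arrowProdEquivProdArrow (Fin k) (fun _ => A) fun _ => B).symm) (t ^ k)
      (tensorMatrix fun _ : Fin k => ρ) (tensorMatrix fun _ : Fin k => σ)).PosSemidef := by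
  -- As for the maximal value: compression to the all-left and all-right indices, using that
  -- `realign` commutes with tensor powers.
  have := (PosSemidef.tensorMatrix fun _ : Fin k => h).submatrix
    (Sum.elim (fun (x : (Fin k → A) × (Fin k → A)) i => Sum.inl (x.1 i, x.2 i))
      fun (x : (Fin k → B) × (Fin k → B)) i => Sum.inr (x.1 i, x.2 i))
  convert this using 1
  ext (x | x) (y | y)
  · simp only [dualMatrix, fromBlocks_apply₁₁, Matrix.smul_apply, kroneckerMap_apply,
      submatrix_apply, Sum.elim_inl, tensorMatrix_apply]
    rw [← tensorMatrix_one]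
    simp [tensorMatrix_apply, Finset.prod_mul_distrib]
  · simp [dualMatrix, realign, tensorMatrix_apply, Equiv.arrowProdEquivProdArrow]
  · simp [dualMatrix, realign, tensorMatrix_apply, Equiv.arrowProdEquivProdArrow]
  · simp only [dualMatrix, fromBlocks_apply₂₂, Matrix.smul_apply, kroneckerMap_apply,
      submatrix_apply, Sum.elim_inr, tensorMatrix_apply]
    rw [← tensorMatrix_one]
    simp [tensorMatrix_apply, Finset.prod_mul_distrib]

end tensorPowers

theorem sum_norm_sq_vecMul_le {m n : Type*} [Fintype m] [Fintype n] [DecidableEq n]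
    {S : Matrix m n ℂ} (hS : Sᴴ * S = 1) (w : m → ℂ) :
    ∑ j, ‖∑ i, w i * S i j‖ ^ 2 ≤ ∑ i, ‖w i‖ ^ 2 := by
  classical
  have hp : (1 - S * Sᴴ).PosSemidef := by
    have : 1 - S * Sᴴ = (1 - S * Sᴴ)ᴴ * (1 - S * Sᴴ) := by
      have h : S * Sᴴ * (S * Sᴴ) = S * Sᴴ := by
        rw [Matrix.mul_assoc, ← Matrix.mul_assoc Sᴴ, hS, Matrix.one_mul]
      simp [Matrix.mul_sub, Matrix.sub_mul, h]
    rw [this]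
    exact posSemidef_conjTranspose_mul_self _
  have h := (Complex.nonneg_iff.1 (hp.dotProduct_mulVec_nonneg (star w))).1
  rw [star_star, sub_mulVec, one_mulVec, dotProduct_sub, ← mulVec_mulVec, dotProduct_mulVec,
    Complex.sub_re, sub_nonneg] at h
  have h1 : (w ⬝ᵥ star w) = ((∑ i, ‖w i‖ ^ 2 : ℝ) : ℂ) := by
    simp [dotProduct, Complex.mul_conj']
  have h2 : (w ᵥ* S) ⬝ᵥ (Sᴴ *ᵥ star w) = ((∑ j, ‖∑ i, w i * S i j‖ ^ 2 : ℝ) : ℂ) := by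
    rw [← star_vecMul]
    simp only [dotProduct, vecMul, Pi.star_apply, RCLike.star_def, Complex.mul_conj']
    push_cast
    rfl
  rw [h1, h2, Complex.ofReal_re, Complex.ofReal_re] at h
  exact h

namespace RankOneGame

variable {A B C : Type*} [Fintype A] [Fintype B] [Fintype C]

theorem sum_auxBlock {n : Type*} [Fintype n] [DecidableEq n] {ι : Type*} [Fintype ι] {d : ℕ}
    {K : ι → Matrix (n × Fin (d + 1)) (n × Fin (d + 1)) ℂ} (hK : ∑ i, (K i)ᴴ * K i = 1) :
    ∑ p : ι × Fin (d + 1), (auxBlock (K p.1) p.2 0)ᴴ * auxBlock (K p.1) p.2 0 = 1 := by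
  ext a a'
  have h := congrFun (congrFun hK (a, 0)) (a', 0)
  simp only [Matrix.sum_apply, Matrix.mul_apply, Matrix.conjTranspose_apply, auxBlock,
    Matrix.of_apply, Fintype.sum_prod_type, Matrix.one_apply, Prod.mk.injEq, and_true] at h ⊢
  rw [← h]
  refine Finset.sum_congr rfl fun i _ => ?_
  rw [Finset.sum_comm]

/-- Linear combinations of Bob's blocks form a row of norm at most that of the coefficients. -/
theorem sum_trace_auxBlock_le {n : Type*} [Fintype n] [DecidableEq n] {ι : Type*} [Fintype ι]
    {d : ℕ} {S : ι → Matrix (n × Fin (d + 1)) (n × Fin (d + 1)) ℂ}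
    (hS : ∑ j, (S j)ᴴ * S j = 1) {σ : Matrix n n ℂ} (hσ : σ ∈ densityMatrices n)
    (c : ι × Fin (d + 1) → ℂ) :
    (∑ f, ((∑ p : ι × Fin (d + 1), c p • auxBlock (S p.1) p.2 f)ᴴ * σ *
      (∑ p : ι × Fin (d + 1), c p • auxBlock (S p.1) p.2 f)).trace).re ≤ ∑ p, ‖c p‖ ^ 2 := by
  obtain ⟨L, hL⟩ := hσ.1.exists_eq_conjTranspose_mul_self
  have hL1 : ∑ b, ∑ l, ‖L l b‖ ^ 2 = 1 := by
    have := trace_conjTranspose_mul_self_eq_sum L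
    rw [← hL, hσ.2] at this
    exact_mod_cast this.symm
  -- Bob's Kraus operators stacked into one isometry; contractivity of Ŝᴴ bounds each row of L,
  -- weighted by c, and σ = Lᴴ L has trace one.
  let Ŝ : Matrix ((ι × Fin (d + 1)) × n) (n × Fin (d + 1)) ℂ :=
    Matrix.of fun p q => S p.1.1 (p.2, p.1.2) q
  have hŜ : Ŝᴴ * Ŝ = 1 := by
    rw [← hS]
    ext q q'
    simp only [Ŝ, Matrix.sum_apply, Matrix.mul_apply, Matrix.conjTranspose_apply,
      Matrix.of_apply, Fintype.sum_prod_type]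
    exact Finset.sum_congr rfl fun i _ => Finset.sum_comm
  have htr : ∀ X : Matrix n n ℂ, (Xᴴ * σ * X).trace = ((∑ b, ∑ l, ‖(L * X) l b‖ ^ 2 : ℝ) : ℂ) := by
    intro X
    rw [← trace_conjTranspose_mul_self_eq_sum, hL, conjTranspose_mul]
    simp only [Matrix.mul_assoc]
  simp_rw [htr]
  rw [← Complex.ofReal_sum, Complex.ofReal_re]
  calc ∑ f, ∑ b, ∑ l, ‖(L * ∑ p : ι × Fin (d + 1), c p • auxBlock (S p.1) p.2 f) l b‖ ^ 2
      = ∑ q : n × Fin (d + 1), ∑ l,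
          ‖∑ x : (ι × Fin (d + 1)) × n, (c x.1 * L l x.2) * Ŝ x q‖ ^ 2 := by
        rw [Fintype.sum_prod_type_right]
        refine Finset.sum_congr rfl fun f _ => Finset.sum_congr rfl fun b _ =>
          Finset.sum_congr rfl fun l _ => ?_
        congr 2
        rw [Matrix.mul_apply, Fintype.sum_prod_type_right (α₂ := n)]
        refine Finset.sum_congr rfl fun b' _ => ?_
        simp only [Matrix.sum_apply, Matrix.smul_apply, auxBlock, Matrix.of_apply, smul_eq_mul,
          Finset.mul_sum, Ŝ]
        exact Finset.sum_congr rfl fun p _ => by ring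
    _ = ∑ l, ∑ q : n × Fin (d + 1),
          ‖∑ x : (ι × Fin (d + 1)) × n, (c x.1 * L l x.2) * Ŝ x q‖ ^ 2 := Finset.sum_comm
    _ ≤ ∑ l, ∑ x : (ι × Fin (d + 1)) × n, ‖c x.1 * L l x.2‖ ^ 2 :=
        Finset.sum_le_sum fun l _ => sum_norm_sq_vecMul_le hŜ _
    _ = ∑ p, ‖c p‖ ^ 2 := by
        rw [Finset.sum_comm, Fintype.sum_prod_type]
        refine Finset.sum_congr rfl fun p _ => ?_
        simp_rw [norm_mul, mul_pow, ← Finset.mul_sum]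
        rw [hL1, mul_one]

variable (G : RankOneGame A B C)

theorem winProb_krausMap_krausMap_le [DecidableEq A] [DecidableEq B] {t : ℝ}
    {ρ : Matrix A A ℂ} {σ : Matrix B B ℂ} (hρ : ρ ∈ densityMatrices A)
    (hσ : σ ∈ densityMatrices B) (hZ : (dualMatrix G.gameMatrix t ρ σ).PosSemidef)
    {ι κ : Type*} [Fintype ι] [Fintype κ] {d : ℕ}
    {T : ι → Matrix (A × Fin (d + 1)) (A × Fin (d + 1)) ℂ}
    {S : κ → Matrix (B × Fin (d + 1)) (B × Fin (d + 1)) ℂ}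
    (hT : ∑ i, (T i)ᴴ * T i = 1) (hS : ∑ j, (S j)ᴴ * S j = 1) :
    G.winProb (applyOn (registersBE A B C (Fin (d + 1))) (krausMap S)
        (applyOn (registersAE A B C (Fin (d + 1))) (krausMap T) (G.initialState d))) ≤ t ^ 2 := by
  rw [winProb_krausMap_krausMap, Finset.sum_comm]
  simp_rw [← Fintype.sum_prod_type' (f := fun (j : κ) (e : Fin (d + 1)) => ‖∑ f, (G.gameMatrix *
        (auxBlock (T _) f 0 ⊗ₖ auxBlock (S j) e f)).trace‖ ^ 2)]
  rw [← Fintype.sum_prod_type' (f := fun (i : ι) (x : κ × Fin (d + 1)) => ‖∑ f, (G.gameMatrix *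
        (auxBlock (T i) f 0 ⊗ₖ auxBlock (S x.1) x.2 f)).trace‖ ^ 2)]
  refine sum_norm_sq_le_of_forall (sq_nonneg t) fun c => ?_
  -- The coefficients are moved onto Bob's side, separately for each outcome i of Alice, leaving her
  -- column normalised.
  have hsum : ∑ x : ι × κ × Fin (d + 1), c x * ∑ f, (G.gameMatrix *
      (auxBlock (T x.1) f 0 ⊗ₖ auxBlock (S x.2.1) x.2.2 f)).trace =
      ∑ y : ι × Fin (d + 1), (G.gameMatrix * (auxBlock (T y.1) y.2 0 ⊗ₖ
        ∑ p : κ × Fin (d + 1), c (y.1, p) • auxBlock (S p.1) p.2 y.2)).trace := by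
    rw [Fintype.sum_prod_type, Fintype.sum_prod_type]
    refine Finset.sum_congr rfl fun i _ => ?_
    simp_rw [Finset.mul_sum]
    rw [Finset.sum_comm]
    refine Finset.sum_congr rfl fun f _ => ?_
    have : auxBlock (T i) f 0 ⊗ₖ (∑ p : κ × Fin (d + 1), c (i, p) • auxBlock (S p.1) p.2 f) =
        ∑ p : κ × Fin (d + 1), c (i, p) • (auxBlock (T i) f 0 ⊗ₖ auxBlock (S p.1) p.2 f) := by
      ext x y
      simp only [Matrix.sum_apply, Matrix.smul_apply, kroneckerMap_apply, Finset.mul_sum,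
        smul_eq_mul]
      exact Finset.sum_congr rfl fun p _ => by ring
    rw [this, Matrix.mul_sum, trace_sum]
    simp_rw [Matrix.mul_smul, trace_smul, smul_eq_mul]
  rw [hsum]
  refine (norm_sum_trace_sq_le_of_dualMatrix hZ hρ.2 hσ.1 _ (sum_auxBlock hT)).trans ?_
  rw [mul_comm]
  gcongr
  rw [Fintype.sum_prod_type, Fintype.sum_prod_type, Complex.re_sum]
  exact Finset.sum_le_sum fun i _ => sum_trace_auxBlock_le hS hσ fun p => c (i, p)

/-- Every amplitude is achieved by Kraus operators. -/
theorem exists_kraus_of_mem_amplitudes [DecidableEq A] [DecidableEq B] {p : ℝ}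
    (hp : p ∈ amplitudes G.gameMatrix) :
    ∃ (d : ℕ) (T : Fin (d + 1) → Matrix (A × Fin (d + 1)) (A × Fin (d + 1)) ℂ)
      (S : Fin 2 → Matrix (B × Fin (d + 1)) (B × Fin (d + 1)) ℂ),
      ∑ i, (T i)ᴴ * T i = 1 ∧ ∑ j, (S j)ᴴ * S j = 1 ∧
      p ^ 2 ≤ G.winProb (applyOn (registersBE A B C (Fin (d + 1))) (krausMap S)
        (applyOn (registersAE A B C (Fin (d + 1))) (krausMap T) (G.initialState d))) := by
  obtain ⟨d, V, R, hV, hR, rfl⟩ := hp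
  -- T_j = ∑ V_e ⊗ |e⟩⟨j|; only j = 0 meets the initial state, the others make the operation trace
  -- preserving.
  let T : Fin (d + 1) → Matrix (A × Fin (d + 1)) (A × Fin (d + 1)) ℂ :=
    fun j => Matrix.of fun x y => if y.2 = j then V x.2 x.1 y.1 else 0
  -- S = ∑ R_f ⊗ |0⟩⟨f|, with S Sᴴ = 1 ⊗ |0⟩⟨0| by the row normalisation, hence a partial isometry
  -- completed by 1 - Sᴴ S.
  let S : Matrix (B × Fin (d + 1)) (B × Fin (d + 1)) ℂ :=
    Matrix.of fun x y => if x.2 = 0 then R y.2 x.1 y.1 else 0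
  have hSS : S * Sᴴ * S = S := by
    ext ⟨b, e⟩ ⟨b', f⟩
    have h : ∀ b₁ e₁, (S * Sᴴ) (b, e) (b₁, e₁) =
        if e = 0 ∧ e₁ = 0 then (1 : Matrix B B ℂ) b b₁ else 0 := by
      intro b₁ e₁
      rw [← hR]
      by_cases he : e = 0 <;> by_cases he₁ : e₁ = 0 <;>
        simp [S, he, he₁, Matrix.mul_apply, Fintype.sum_prod_type_right, Matrix.sum_apply]
    rw [Matrix.mul_apply, Fintype.sum_prod_type]
    simp_rw [h]
    by_cases he : e = 0
    · simp [he, S, Matrix.one_apply]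
    · simp [he, S]
  refine ⟨d, T, ![S, 1 - Sᴴ * S], ?_, ?_, ?_⟩
  · ext ⟨a, e⟩ ⟨a', f⟩
    have h := congrFun (congrFun hV a) a'
    simp only [Matrix.sum_apply, Matrix.mul_apply, Matrix.conjTranspose_apply] at h
    simp only [Matrix.sum_apply, Matrix.mul_apply, Matrix.conjTranspose_apply, T, Matrix.of_apply,
      Fintype.sum_prod_type_right]
    rw [Finset.sum_eq_single e]
    · by_cases hef : f = e
      · subst hef
        simpa [Matrix.one_apply] using h
      · simp [hef, Ne.symm hef]
    · intro j _ hj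
      simp [Ne.symm hj]
    · simp
  · have : Sᴴ * S * (Sᴴ * S) = Sᴴ * S := by
      rw [Matrix.mul_assoc, ← Matrix.mul_assoc S, hSS]
    simp [Fin.sum_univ_two, Matrix.mul_sub, Matrix.sub_mul, this]
  · rw [winProb_krausMap_krausMap]
    let F : Fin 2 → Fin (d + 1) → Fin (d + 1) → ℝ := fun j i e => ‖∑ f, (G.gameMatrix *
      (auxBlock (T i) f 0 ⊗ₖ auxBlock ((![S, 1 - Sᴴ * S] : Fin 2 → _) j) e f)).trace‖ ^ 2
    have hF : ∀ j i e, 0 ≤ F j i e := fun _ _ _ => sq_nonneg _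
    have hF0 : ‖∑ e, (G.gameMatrix * (V e ⊗ₖ R e)).trace‖ ^ 2 = F 0 0 0 := by
      have hTV : ∀ f, auxBlock (T 0) f 0 = V f := fun f => by
        ext a a'
        simp [auxBlock, T]
      have hSR : ∀ f, auxBlock S 0 f = R f := fun f => by
        ext b b'
        simp [auxBlock, S]
      simp [F, hTV, hSR]
    calc _ = F 0 0 0 := hF0
      _ ≤ ∑ e, F 0 0 e := Finset.single_le_sum (fun e _ => hF 0 0 e) (Finset.mem_univ 0)
      _ ≤ ∑ i, ∑ e, F 0 i e := Finset.single_le_sum (f := fun i => ∑ e, F 0 i e)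
          (fun i _ => Finset.sum_nonneg fun e _ => hF 0 i e) (Finset.mem_univ 0)
      _ ≤ ∑ j, ∑ i, ∑ e, F j i e := Finset.single_le_sum (f := fun j => ∑ i, ∑ e, F j i e)
          (fun j _ => Finset.sum_nonneg fun i _ => Finset.sum_nonneg fun e _ => hF j i e)
          (Finset.mem_univ 0)

theorem oneWayValue_eq_sq [DecidableEq A] [DecidableEq B] {t : ℝ}
    {ρ : Matrix A A ℂ} {σ : Matrix B B ℂ} (hρ : ρ ∈ densityMatrices A)
    (hσ : σ ∈ densityMatrices B) (hZ : (dualMatrix G.gameMatrix t ρ σ).PosSemidef)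
    (ht : t ∈ closure (amplitudes G.gameMatrix)) : G.oneWayValue = t ^ 2 := by
  have hub : ∀ p ∈ {p : ℝ | ∃ (d : ℕ)
      (T : Matrix (A × Fin (d + 1)) (A × Fin (d + 1)) ℂ →ₗ[ℂ]
        Matrix (A × Fin (d + 1)) (A × Fin (d + 1)) ℂ)
      (S : Matrix (B × Fin (d + 1)) (B × Fin (d + 1)) ℂ →ₗ[ℂ]
        Matrix (B × Fin (d + 1)) (B × Fin (d + 1)) ℂ),
      IsQuantumOperation T ∧ IsQuantumOperation S ∧
        p = G.winProb (applyOn (registersBE A B C (Fin (d + 1))) S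
          (applyOn (registersAE A B C (Fin (d + 1))) T (G.initialState d)))}, p ≤ t ^ 2 := by
    rintro p ⟨d, T, S, hT, hS, rfl⟩
    obtain ⟨N, K, rfl, hK⟩ := hT.exists_kraus
    obtain ⟨N', K', rfl, hK'⟩ := hS.exists_kraus
    exact G.winProb_krausMap_krausMap_le hρ hσ hZ hK hK'
  refine le_antisymm (Real.sSup_le hub (sq_nonneg t)) ?_
  -- The auxiliary dimension is unbounded, so attainment of t is not assumed; membership in the
  -- closure suffices because the inequality is closed.
  have hcl : IsClosed {p : ℝ | p ^ 2 ≤ G.oneWayValue} :=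
    isClosed_le (by fun_prop) continuous_const
  refine closure_minimal (fun p hp => ?_) hcl ht
  obtain ⟨d, T, S, hT, hS, hle⟩ := G.exists_kraus_of_mem_amplitudes hp
  exact hle.trans (le_csSup ⟨_, hub⟩ ⟨d, _, _, isQuantumOperation_krausMap hT,
    isQuantumOperation_krausMap hS, rfl⟩)

theorem nonempty_registers (G : RankOneGame A B C) : Nonempty (A × B × C) := by
  by_contra h
  rw [not_nonempty_iff] at h
  have := G.norm_ψ
  rw [Subsingleton.elim G.ψ 0, norm_zero] at this
  exact zero_ne_one this

theorem oneWayValue_parallel [DecidableEq A] [DecidableEq B] (k : ℕ) :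
    (G.parallel k).oneWayValue = G.oneWayValue ^ k := by
  classical
  -- Unit vectors force nonempty registers, which the existence of states ρ, σ requires.
  obtain ⟨a, b, c⟩ := G.nonempty_registers
  have : Nonempty A := ⟨a⟩
  have : Nonempty B := ⟨b⟩
  have hne : (amplitudes G.gameMatrix).Nonempty :=
    ⟨_, mem_amplitudes (ι := Unit) (V := fun _ => 1) (R := fun _ => 1) _ (by simp) (by simp)⟩
  have hbdd := bddAbove_amplitudes G.gameMatrix
  set t := sSup (amplitudes G.gameMatrix)
  have ht0 : 0 ≤ t := by
    refine Real.sSup_nonneg ?_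
    rintro p ⟨d, V, R, -, -, rfl⟩
    exact norm_nonneg _
  have hcl : t ∈ closure (amplitudes G.gameMatrix) := csSup_mem_closure hne hbdd
  obtain ⟨ρ, hρ, σ, hσ, hZ⟩ := exists_posSemidef_dualMatrix ht0 fun p hp => le_csSup hbdd hp
  rw [G.oneWayValue_eq_sq hρ hσ hZ hcl, ← pow_mul, mul_comm, pow_mul]
  refine (G.parallel k).oneWayValue_eq_sq (tensorMatrix_mem_densityMatrices hρ k)
    (tensorMatrix_mem_densityMatrices hσ k) ?_ ?_
  · rw [gameMatrix_parallel]
    exact posSemidef_dualMatrix_tensorMatrix hZ k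
  · rw [gameMatrix_parallel]
    exact map_mem_closure (f := fun p : ℝ => p ^ k) (continuous_pow k) hcl fun p hp => pow_mem_amplitudes hp k

end RankOneGame

end

theorem mainTheorem4 {A B C : Type*} [Fintype A] [Fintype B] [Fintype C]
    [DecidableEq A] [DecidableEq B] (G : RankOneGame A B C) (k : ℕ) :
    G.maximalValue = traceNorm G.gameMatrix ^ 2 ∧
    (G.parallel k).maximalValue = G.maximalValue ^ k ∧
    (G.parallel k).oneWayValue = G.oneWayValue ^ k := by
  exact ⟨G.maximalValue_eq_traceNorm, G.maximalValue_parallel k, G.oneWayValue_parallel k⟩
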